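/- Let $(U_i)_{i\ge1}$ be i.i.d. random variables uniformly distributed on $[0,1]$, let $F_n(x)=n^{-1}\#\{1\le i\le n: U_i\le x\}$ and $\alpha_n(x)=\sqrt n\,(F_n(x)-x)$, and for $t\in[0,1)$, $h>0$ put $\mathcal D_{n,h,t}(s)=\alpha_n(t+hs)-\alpha_n(t)$, $s\in[0,1]$ (with the same formula when $t+hs>1$). Write $\log_2 u=\log(\log(\max(u,3)))$ and $\|f\|=\sup_{s\in[0,1]}|f(s)|$, and let $$\mathcal S=\Big\{g:[0,1]\to\mathbb R \text{ absolutely continuous},\ g(0)=0,\ \int_0^1\dot g(x)^2\,dx\le1\Big\}$$ be the Strassen ball. A sequence $(h_n)_{n\ge1}$ of strictly positive constants is said to satisfy the local strong invariance conditions if, ultimately as $n\to\infty$, $h_n\downarrow0$ and $nh_n\uparrow\infty$ (both monotone in the wide sense), and $nh_n/\log_2 n\to\infty$. Theorem. Let $(\mathfrak h_n)_{n\ge1}$ and $(h_n)_{n\ge1}$ be two sequences satisfying the local strong invariance conditions, with $\mathfrak h_n<\frac12h_n$ for all $n\ge1$, and let $t\in[0,1)$. Then, almost surely, $$\lim_{n\to\infty}\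 \sup_{\mathfrak h_n\le h\le h_n}\ \inf_{g\in\sqrt2\,\mathcal S}\ \Big\|\frac{\mathcal D_{n,h,t}}{(2h\log_2 n)^{1/2}}-g\Big\|=0 .$$ -/

import Mathlib

open MeasureTheory ProbabilityTheory Filter Topology Set
open scoped ENNReal Pointwise

namespace LocalEmpirical

/-- The iterated logarithm `log₂ u = log (log (max u 3))`. -/
noncomputable def log2 (u : ℝ) : ℝ := Real.log (Real.log (max u 3))

/-- The local strong invariance conditions for a sequence `(h n)`, `n ≥ 1`, of strictly positive
constants: ultimately `h n ↓ 0` and `n * h n ↑ ∞` (monotone in the wide sense),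
and `n * h n / log₂ n → ∞`. The value `h 0` plays no role. -/
structure LocalStrongInvariance (h : ℕ → ℝ) : Prop where
  pos : ∀ n, 1 ≤ n → 0 < h n
  eventually_antitone : ∀ᶠ n in atTop, h (n + 1) ≤ h n
  tendsto_zero : Tendsto h atTop (𝓝 0)
  eventually_monotone : ∀ᶠ n : ℕ in atTop, (n : ℝ) * h n ≤ ((n + 1 : ℕ) : ℝ) * h (n + 1)
  tendsto_mul : Tendsto (fun n : ℕ => (n : ℝ) * h n) atTop atTop
  tendsto_div : Tendsto (fun n : ℕ => (n : ℝ) * h n / log2 n) atTop atTop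

/-- The empirical distribution function of the first `n` terms `u 0, …, u (n - 1)`. -/
noncomputable def empiricalCDF (u : ℕ → ℝ) (n : ℕ) (x : ℝ) : ℝ :=
  (n : ℝ)⁻¹ * (((Finset.range n).filter fun i => u i ≤ x).card : ℝ)

/-- The uniform empirical process `α_n(x) = √n (F_n(x) - x)`. -/
noncomputable def empiricalProcess (u : ℕ → ℝ) (n : ℕ) (x : ℝ) : ℝ :=
  √(n : ℝ) * (empiricalCDF u n x - x)

/-- The local empirical process `D_{n,h,t}(s) = α_n(t + h s) - α_n(t)`. -/
noncomputable def localProcess (u : ℕ → ℝ) (n : ℕ) (h t : ℝ) (s : ℝ) : ℝ :=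
  empiricalProcess u n (t + h * s) - empiricalProcess u n t

/-- The supremum norm on `[0,1]`, with values in `[0,∞]`. -/
noncomputable def supNorm (f : ℝ → ℝ) : ℝ≥0∞ := ⨆ s ∈ Icc (0 : ℝ) 1, ‖f s‖ₑ

/-- The squared Hilbertian norm `∫₀¹ (g')²`, with values in `[0,∞]`. -/
noncomputable def hilbertNormSq (g : ℝ → ℝ) : ℝ≥0∞ :=
  ∫⁻ x in Icc (0 : ℝ) 1, ENNReal.ofReal (deriv g x ^ 2)

/-- The Strassen ball. Only the restrictions of its elements to `[0,1]` matter. -/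
def strassenBall : Set (ℝ → ℝ) :=
  {g | AbsolutelyContinuousOnInterval g 0 1 ∧ g 0 = 0 ∧ hilbertNormSq g ≤ 1}

end LocalEmpirical

/-! Cut `[0,1]` into `m` cells. If a function oscillates little on each cell and its `m` increments
`x j` satisfy `m * ∑ x j ^ 2 ≤ 2 (1 + θ)²`, its polygonal interpolant, slightly shrunk, lies in `√2
• strassenBall` and is uniformly close to it (`exists_near_strassenBall`). It remains to show that
the local process has both properties, uniformly in the scale.

For a unit vector `v`, the linear combination of increments of the centred count over cells of
length `h / m` has variance at most about `N h / m`. Exceeding `2 √(N h L / m)`, with a margin `1 +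
η`, therefore has probability at most `exp (-(2 + η) L)`, and Doob's inequality makes this uniform
in `n ≤ N`. A finite net of directions converts these bounds into an energy bound; dyadic chaining
controls the oscillation at the same rate.

The radius `√2` comes from counting scales. Take `N = ⌈ρ ^ r⌉`, `L = log2 N` (roughly `log r`) and
scales `ρ ^ (-l)`. The condition `N h ≥ c L` leaves only `O(r)` scales, so the bad events at stage
`r` have total probability `O(r * r ^ (-(2 + η)))`, which is summable. Borel–Cantelli gives
regularity on the grid. With `ρ = 1 + 1 / m`, an arbitrary pair `(n, b)` is comparable with a grid
pair, and passing from `b` to the grid scale moves time by at most one cell. -/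

namespace LocalEmpirical

variable {Ω : Type*} [MeasurableSpace Ω] {P : Measure Ω}

/-! ### Polygonal approximation and the Strassen ball -/

/-- The piecewise linear function on `[0,1]` vanishing at `0` with increment `x j` on the cell
`[j / m, (j + 1) / m]`. -/
noncomputable def polygon (m : ℕ) (x : ℕ → ℝ) (s : ℝ) : ℝ :=
  ∑ j ∈ Finset.range m, x j * max 0 (min 1 (m * s - j))

lemma polygon_zero (m : ℕ) (x : ℕ → ℝ) : polygon m x 0 = 0 := by
  refine Finset.sum_eq_zero fun j _ => ?_
  have : (0 : ℝ) ≤ j := j.cast_nonneg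
  rw [max_eq_left, mul_zero]
  exact min_le_of_right_le (by linarith)

lemma polygon_eq (m : ℕ) (x : ℕ → ℝ) {k : ℕ} (hk : k < m) {s : ℝ} (h1 : (k : ℝ) ≤ m * s)
    (h2 : m * s ≤ k + 1) :
    polygon m x s = ∑ j ∈ Finset.range k, x j + x k * (m * s - k) := by
  have hsub : Finset.range (k + 1) ⊆ Finset.range m := by
    intro j; simp only [Finset.mem_range]; omega
  rw [polygon, ← Finset.sum_subset hsub, Finset.sum_range_succ]
  · congr 1
    · refine Finset.sum_congr rfl fun j hj => ?_
      have : (j : ℝ) + 1 ≤ k := by exact_mod_cast Finset.mem_range.1 hj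
      rw [min_eq_left (by linarith), max_eq_right zero_le_one, mul_one]
    · rw [min_eq_right (by linarith), max_eq_right (by linarith)]
  · intro j _ hj
    have : (k : ℝ) + 1 ≤ j := by
      have : k + 1 ≤ j := by simpa using hj
      exact_mod_cast this
    rw [max_eq_left, mul_zero]
    exact min_le_of_right_le (by linarith)

lemma abs_clamp_sub_le (a b : ℝ) :
    |max 0 (min 1 a) - max 0 (min 1 b)| ≤ |a - b| := by
  have h1 := abs_max_sub_max_le_abs (min 1 a) (min 1 b) 0
  have h2 := abs_min_sub_min_le_max 1 a 1 b
  rw [max_comm 0 (min 1 a), max_comm 0 (min 1 b)]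
  refine h1.trans (h2.trans ?_)
  simp

lemma polygon_absolutelyContinuous (m : ℕ) (x : ℕ → ℝ) :
    AbsolutelyContinuousOnInterval (polygon m x) 0 1 := by
  have hK : (0 : ℝ) ≤ ∑ j ∈ Finset.range m, |x j| * m :=
    Finset.sum_nonneg fun j _ => by positivity
  have : LipschitzWith (∑ j ∈ Finset.range m, |x j| * m).toNNReal (polygon m x) := by
    refine LipschitzWith.of_dist_le_mul fun s s' => ?_
    rw [Real.dist_eq, Real.dist_eq, Real.coe_toNNReal _ hK, polygon, polygon, ← Finset.sum_sub_distrib,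
      Finset.sum_mul]
    refine (Finset.abs_sum_le_sum_abs _ _).trans (Finset.sum_le_sum fun j _ => ?_)
    rw [← mul_sub, abs_mul, mul_assoc]
    refine mul_le_mul_of_nonneg_left ((abs_clamp_sub_le _ _).trans (le_of_eq ?_)) (abs_nonneg _)
    rw [sub_sub_sub_cancel_right, ← mul_sub, abs_mul, Nat.abs_cast]
  exact (this.lipschitzOnWith (s := uIcc 0 1)).absolutelyContinuousOnInterval

lemma deriv_polygon (m : ℕ) (x : ℕ → ℝ) {k : ℕ} (hk : k < m) {s : ℝ} (h1 : (k : ℝ) < m * s)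
    (h2 : m * s < k + 1) : deriv (polygon m x) s = m * x k := by
  have hev : polygon m x =ᶠ[𝓝 s]
      fun s => ∑ j ∈ Finset.range k, x j + x k * (m * s - k) := by
    have c : Continuous fun s : ℝ => (m : ℝ) * s := by fun_prop
    filter_upwards [(isOpen_lt continuous_const c).mem_nhds h1,
      (isOpen_lt c continuous_const).mem_nhds h2] with y hy1 hy2
    exact polygon_eq m x hk (le_of_lt hy1) (le_of_lt hy2)
  rw [hev.deriv_eq]
  have : HasDerivAt (fun s : ℝ => ∑ j ∈ Finset.range k, x j + x k * (m * s - k))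
      (x k * (m * 1)) s :=
    (((((hasDerivAt_id s).const_mul (m : ℝ)).sub_const (k : ℝ)).const_mul (x k)).const_add _)
  rw [this.deriv]; ring

/-- Every point of `[0,1]` lies in one of the cells `[k / m, (k + 1) / m]`. -/
lemma exists_cell {m : ℕ} (hm : 0 < m) {s : ℝ} (hs : s ∈ Icc (0 : ℝ) 1) :
    ∃ k < m, (k : ℝ) ≤ m * s ∧ m * s ≤ k + 1 := by
  have hm' : (0 : ℝ) < m := by exact_mod_cast hm
  rcases eq_or_lt_of_le hs.2 with h | h
  · refine ⟨m - 1, by omega, ?_⟩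
    rw [Nat.cast_sub (by omega), h]
    constructor <;> simp
  · refine ⟨⌊(m : ℝ) * s⌋₊, ?_, Nat.floor_le (by have := hs.1; positivity),
      (Nat.lt_floor_add_one _).le⟩
    rw [Nat.floor_lt (by have := hs.1; positivity)]
    nlinarith

/-- A slope `m * x j` on a cell of length `1 / m` contributes `m * x j ^ 2`; the cells only overlap
at endpoints, so subadditivity over the cover suffices. -/
lemma hilbertNormSq_polygon_le {m : ℕ} (hm : 0 < m) (x : ℕ → ℝ) :
    hilbertNormSq (polygon m x) ≤ ENNReal.ofReal (m * ∑ j ∈ Finset.range m, x j ^ 2) := by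
  have hm' : (0 : ℝ) < m := by exact_mod_cast hm
  have hcov : Icc (0 : ℝ) 1 ⊆ ⋃ j : Fin m, Icc ((j : ℝ) / m) ((j + 1) / m) := by
    intro s hs
    obtain ⟨k, hk, h1, h2⟩ := exists_cell hm hs
    refine mem_iUnion.2 ⟨⟨k, hk⟩, ?_, ?_⟩
    · rw [div_le_iff₀ hm']; simpa [mul_comm] using h1
    · rw [le_div_iff₀ hm']; simpa [mul_comm] using h2
  have hcell : ∀ j ∈ Finset.range m, ∫⁻ s in Icc ((j : ℝ) / m) ((j + 1) / m),
      ENNReal.ofReal (deriv (polygon m x) s ^ 2) = ENNReal.ofReal (m * x j ^ 2) := by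
    intro j hj
    rw [setLIntegral_congr (Ioo_ae_eq_Icc (a := (j : ℝ) / m) (b := (j + 1) / m)).symm,
      setLIntegral_congr_fun (g := fun _ => ENNReal.ofReal ((m * x j) ^ 2)) measurableSet_Ioo,
      setLIntegral_const, Real.volume_Ioo, ← ENNReal.ofReal_mul (by positivity)]
    · congr 1
      field_simp
      ring
    · intro s hs
      have h1 := (div_lt_iff₀ hm').1 hs.1
      have h2 := (lt_div_iff₀ hm').1 hs.2
      simp only
      rw [deriv_polygon m x (Finset.mem_range.1 hj) (by linarith) (by linarith)]
  calc hilbertNormSq (polygon m x)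
      ≤ ∫⁻ s in ⋃ j : Fin m, Icc ((j : ℝ) / m) ((j + 1) / m),
          ENNReal.ofReal (deriv (polygon m x) s ^ 2) := lintegral_mono_set hcov
    _ ≤ ∑ j ∈ Finset.range m, ∫⁻ s in Icc ((j : ℝ) / m) ((j + 1) / m),
          ENNReal.ofReal (deriv (polygon m x) s ^ 2) := by
        refine (lintegral_iUnion_le _ _).trans_eq ?_
        rw [tsum_fintype, Fin.sum_univ_eq_sum_range (fun j : ℕ =>
          ∫⁻ s in Icc ((j : ℝ) / m) ((j + 1) / m), ENNReal.ofReal (deriv (polygon m x) s ^ 2))]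
    _ = _ := by
        rw [Finset.sum_congr rfl hcell, ← ENNReal.ofReal_sum_of_nonneg fun j _ => by positivity,
          Finset.mul_sum]

lemma polygon_mem_strassenBall {m : ℕ} (hm : 0 < m) {x : ℕ → ℝ}
    (hx : m * ∑ j ∈ Finset.range m, x j ^ 2 ≤ 1) : polygon m x ∈ strassenBall :=
  ⟨polygon_absolutelyContinuous m x, polygon_zero m x,
    (hilbertNormSq_polygon_le hm x).trans (by simpa using ENNReal.ofReal_le_ofReal hx)⟩

lemma polygon_const_mul (m : ℕ) (x : ℕ → ℝ) (c s : ℝ) :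
    polygon m (fun j => c * x j) s = c * polygon m x s := by
  simp only [polygon, Finset.mul_sum, mul_assoc]

/-- Cauchy–Schwarz, each ramp having values in `[0,1]`. This bounds the cost of shrinking a polygon
into the ball. -/
lemma sq_polygon_le (m : ℕ) (x : ℕ → ℝ) (s : ℝ) :
    polygon m x s ^ 2 ≤ m * ∑ j ∈ Finset.range m, x j ^ 2 := by
  refine (Finset.sum_mul_sq_le_sq_mul_sq _ _ _).trans ?_
  rw [mul_comm]
  refine mul_le_mul_of_nonneg_right ?_ (Finset.sum_nonneg fun j _ => sq_nonneg _)
  refine (Finset.sum_le_sum (g := fun _ => (1 : ℝ)) fun j _ => ?_).trans (by simp)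
  have h0 : (0 : ℝ) ≤ max 0 (min 1 (m * s - j)) := le_max_left _ _
  have h1 : max 0 (min 1 ((m : ℝ) * s - j)) ≤ 1 := max_le zero_le_one (min_le_left _ _)
  nlinarith

/-- A function with small oscillation on the cells of a mesh whose increments have controlled
energy is close to the dilated Strassen ball, also after a slight change of time. -/
lemma exists_near_strassenBall {m : ℕ} (hm : 0 < m) {W : ℝ → ℝ} (hW0 : W 0 = 0) {e θ β : ℝ}
    (he : 0 ≤ e) (hθ : 0 ≤ θ)
    (hosc : ∀ j < m, ∀ s, (j : ℝ) ≤ m * s → m * s ≤ j + 1 → |W s - W (j / m)| ≤ e)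
    (henergy : m * ∑ j ∈ Finset.range m, (W ((j + 1 : ℕ) / m) - W (j / m)) ^ 2
      ≤ 2 * (1 + θ) ^ 2)
    (hβ0 : 0 ≤ β) (hβ1 : β ≤ 1) (hβ : m * (1 - β) ≤ 1) :
    ∃ g ∈ √(2 : ℝ) • strassenBall, ∀ s ∈ Icc (0 : ℝ) 1, |W (β * s) - g s| ≤ 5 * e + 2 * θ := by
  have hm' : (0 : ℝ) < m := by exact_mod_cast hm
  have h2 : (0 : ℝ) < √2 := by positivity
  have h22 : √(2 : ℝ) ^ 2 = 2 := Real.sq_sqrt (by norm_num)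
  set x : ℕ → ℝ := fun j => W ((j + 1 : ℕ) / m) - W (j / m) with hx
  have htel : ∀ k, ∑ j ∈ Finset.range k, x j = W (k / m) := by
    intro k
    rw [hx, Finset.sum_range_sub (fun j : ℕ => W ((j : ℝ) / m))]
    simp [hW0]
  have hxe : ∀ j < m, |x j| ≤ e := by
    intro j hj
    refine hosc j hj _ ?_ ?_
    · rw [mul_div_cancel₀ _ hm'.ne']; push_cast; linarith
    · rw [mul_div_cancel₀ _ hm'.ne']; push_cast; linarith
  have hpoly : ∀ s ∈ Icc (0 : ℝ) 1, |W s - polygon m x s| ≤ 2 * e := by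
    intro s hs
    obtain ⟨k, hk, h1, h2⟩ := exists_cell hm hs
    rw [polygon_eq m x hk h1 h2, htel]
    have h3 := hosc k hk s h1 h2
    have h4 : |x k * (m * s - k)| ≤ e := by
      rw [abs_mul]
      have : |m * s - k| ≤ 1 := abs_le.2 ⟨by linarith, by linarith⟩
      nlinarith [hxe k hk, abs_nonneg (x k), abs_nonneg (m * s - k)]
    rw [abs_le] at *
    constructor <;> linarith
  -- By `hβ`, `β * s` and `s` lie in the same cell or in adjacent ones; in the adjacent case the
  -- path crosses at most three oscillations.
  have hshift : ∀ s ∈ Icc (0 : ℝ) 1, |W (β * s) - W s| ≤ 3 * e := by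
    intro s hs
    have hβs : β * s ∈ Icc (0 : ℝ) 1 :=
      ⟨mul_nonneg hβ0 hs.1, by nlinarith [hs.1, hs.2]⟩
    have hle : β * s ≤ s := by nlinarith [hs.1]
    have hcl : m * s - m * (β * s) ≤ 1 := by
      have : m * s - m * (β * s) = m * (1 - β) * s := by ring
      rw [this]
      nlinarith [hs.1, hs.2, mul_nonneg hm'.le (sub_nonneg.2 hβ1)]
    obtain ⟨k, hk, h1, h2⟩ := exists_cell hm hβs
    have hms : (m : ℝ) * (β * s) ≤ m * s := mul_le_mul_of_nonneg_left hle hm'.le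
    have h3 := hosc k hk _ h1 h2
    rcases le_total ((m : ℝ) * s) (k + 1) with h | h
    · have h4 := hosc k hk s (by linarith) h
      rw [abs_le] at *
      constructor <;> linarith
    · rcases (Nat.succ_le_of_lt hk).eq_or_lt with h' | h'
      · have hk1 : (k : ℝ) + 1 = m := by exact_mod_cast h'
        have hs1 : s = 1 := le_antisymm hs.2 (by
          rw [hk1] at h; exact (le_mul_iff_one_le_right hm').1 h)
        have h4 := hosc k hk s (by linarith) (by rw [hs1]; linarith)
        rw [abs_le] at *
        constructor <;> linarith
      · have h4 := hosc (k + 1) h' s (by push_cast; linarith) (by push_cast; linarith)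
        have h5 := hxe k hk
        simp only [hx] at h5
        rw [abs_le] at *
        constructor <;> linarith
  -- Multiplying by `c` brings the energy down to `1`; restoring the factor `√2` leaves a shrinkage
  -- by `1 + θ`, which moves the polygon by at most `√2 * θ`.
  set c : ℝ := (√2 * (1 + θ))⁻¹ with hc
  have hc0 : 0 < c := by positivity
  refine ⟨√2 • polygon m (fun j => c * x j),
    smul_mem_smul_set (polygon_mem_strassenBall hm ?_), ?_⟩
  · simp only [mul_pow, ← Finset.mul_sum]
    have : c ^ 2 * (2 * (1 + θ) ^ 2) = 1 := by
      rw [hc, inv_pow, mul_pow, h22, inv_mul_cancel₀ (by positivity)]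
    calc _ = c ^ 2 * (m * ∑ j ∈ Finset.range m, x j ^ 2) := by ring
      _ ≤ c ^ 2 * (2 * (1 + θ) ^ 2) := mul_le_mul_of_nonneg_left henergy (by positivity)
      _ = 1 := this
  · intro s hs
    have hp : |polygon m x s| ≤ √2 * (1 + θ) := by
      refine abs_le_of_sq_le_sq ?_ (by positivity)
      rw [mul_pow, h22]
      exact (sq_polygon_le m x s).trans henergy
    have heq : (√2 • polygon m fun j => c * x j) s = (1 + θ)⁻¹ * polygon m x s := by
      rw [Pi.smul_apply, smul_eq_mul, polygon_const_mul, hc, mul_inv, ← mul_assoc, ← mul_assoc,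
        mul_inv_cancel₀ h2.ne', one_mul]
    rw [heq]
    have hd : |polygon m x s - (1 + θ)⁻¹ * polygon m x s| ≤ 2 * θ := by
      have : polygon m x s - (1 + θ)⁻¹ * polygon m x s
          = polygon m x s * (θ / (1 + θ)) := by field_simp; ring
      rw [this, abs_mul, abs_of_nonneg (by positivity : 0 ≤ θ / (1 + θ))]
      calc _ ≤ √2 * (1 + θ) * (θ / (1 + θ)) := mul_le_mul_of_nonneg_right hp (by positivity)
        _ = √2 * θ := by field_simp
        _ ≤ 2 * θ := by
          refine mul_le_mul_of_nonneg_right ?_ hθ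
          nlinarith
    have h3 := hpoly s hs
    have h4 := hshift s hs
    rw [abs_le] at *
    constructor <;> linarith

/-! ### Centred counts and deterministic chaining -/

/-- The centred counting process `y ↦ ∑_{i < n} (𝟙{u i ≤ y} - y)`. -/
noncomputable def centredCount (u : ℕ → ℝ) (n : ℕ) (y : ℝ) : ℝ :=
  ∑ i ∈ Finset.range n, ((Iic y).indicator 1 (u i) - y)

lemma localProcess_eq (u : ℕ → ℝ) {n : ℕ} (hn : 0 < n) (h t s : ℝ) :
    localProcess u n h t s = (centredCount u n (t + h * s) - centredCount u n t) / √n := by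
  have hn' : (0 : ℝ) < n := by exact_mod_cast hn
  have key : ∀ y, empiricalProcess u n y = centredCount u n y / √n := by
    intro y
    have h1 : centredCount u n y
        = (((Finset.range n).filter fun i => u i ≤ y).card : ℝ) - n * y := by
      simp [centredCount, Finset.sum_sub_distrib, indicator_apply, Finset.sum_boole]
    rw [h1, empiricalProcess, empiricalCDF, eq_div_iff (by positivity)]
    have : √(n : ℝ) * √n = n := Real.mul_self_sqrt hn'.le
    calc _ = (√(n : ℝ) * √n) * ((n : ℝ)⁻¹ *
            (((Finset.range n).filter fun i => u i ≤ y).card : ℝ) - y) := by ring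
      _ = _ := by rw [this]; field_simp
  rw [localProcess, key, key, sub_div]

lemma centredCount_sub (u : ℕ → ℝ) (n : ℕ) {a b : ℝ} (hab : a ≤ b) :
    centredCount u n b - centredCount u n a
      = ∑ i ∈ Finset.range n, ((Ioc a b).indicator 1 (u i) - (b - a)) := by
  rw [centredCount, centredCount, ← Finset.sum_sub_distrib]
  refine Finset.sum_congr rfl fun i _ => ?_
  by_cases h1 : u i ≤ a
  · have h2 : u i ≤ b := h1.trans hab
    simp [h1, h2, not_lt.2 h1]
  · by_cases h2 : u i ≤ b
    · simp [h1, h2, not_le.1 h1]; ring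
    · simp [h1, h2]; ring

/-- The count is nondecreasing, so only the drift `-n y` can make the process fall. In the chaining
this one-sided bound replaces continuity. -/
lemma centredCount_sub_ge (u : ℕ → ℝ) (n : ℕ) {a b : ℝ} (hab : a ≤ b) :
    -(n * (b - a)) ≤ centredCount u n b - centredCount u n a := by
  rw [centredCount_sub u n hab, Finset.sum_sub_distrib]
  have : (0 : ℝ) ≤ ∑ i ∈ Finset.range n, (Ioc a b).indicator (1 : ℝ → ℝ) (u i) :=
    Finset.sum_nonneg fun i _ => indicator_nonneg (fun _ _ => zero_le_one) _
  simp only [Finset.sum_const, Finset.card_range, nsmul_eq_mul]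
  linarith

/-- Dyadic chaining: increments along the dyadic points up to level `K` and a one-sided Lipschitz
bound control the function on the whole interval. -/
lemma abs_sub_le_of_dyadic {E : ℝ → ℝ} {C a l : ℝ} (hl : 0 ≤ l) (hC : 0 ≤ C)
    (hE : ∀ y z, y ≤ z → -(C * (z - y)) ≤ E z - E y) {x : ℕ → ℝ} {K : ℕ}
    (hx : ∀ k ≤ K, ∀ i < 2 ^ k,
      |E (a + l * ((i + 1 : ℕ) / 2 ^ k)) - E (a + l * (i / 2 ^ k))| ≤ x k)
    {y : ℝ} (hy : y ∈ Icc a (a + l)) :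
    |E y - E a| ≤ ∑ k ∈ Finset.range (K + 1), x k + C * (l / 2 ^ K) := by
  have hx0 : ∀ k ≤ K, 0 ≤ x k := fun k hk =>
    (abs_nonneg _).trans (hx k hk 0 (by positivity))
  have hgrid : ∀ k ≤ K, ∀ i : ℕ, i ≤ 2 ^ k →
      |E (a + l * (i / 2 ^ k)) - E a| ≤ ∑ k' ∈ Finset.range (k + 1), x k' := by
    intro k
    induction k with
    | zero =>
      intro hk i hi
      have hi' : i = 0 ∨ i = 1 := by rw [pow_zero] at hi; omega
      rcases hi' with rfl | rfl
      · simpa using hx0 0 hk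
      · have := hx 0 hk 0 (by norm_num)
        simpa using this
    | succ k ih =>
      intro hk i hi
      have hkK : k ≤ K := by omega
      have heven : ∀ j : ℕ, ((2 * j : ℕ) : ℝ) / 2 ^ (k + 1) = j / 2 ^ k := by
        intro j; push_cast; rw [pow_succ]; field_simp
      rw [Finset.sum_range_succ]
      rcases Nat.even_or_odd' i with ⟨j, rfl | rfl⟩
      · rw [heven]
        have := ih hkK j (by rw [pow_succ] at hi; omega)
        linarith [hx0 (k + 1) hk]
      · have h1 := ih hkK j (by rw [pow_succ] at hi; omega)
        have h2 := hx (k + 1) hk (2 * j) (by omega)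
        rw [heven] at h2
        rw [abs_le] at *
        constructor <;> linarith
  rcases hl.eq_or_lt with rfl | hl'
  · have : y = a := le_antisymm (by simpa using hy.2) hy.1
    rw [this]
    simp only [sub_self, abs_zero, zero_div, mul_zero, add_zero]
    exact Finset.sum_nonneg fun k hk => hx0 k (by simpa [Nat.lt_succ_iff] using hk)
  obtain ⟨k, hk, h1, h2⟩ := exists_cell (m := 2 ^ K) (by positivity) (s := (y - a) / l)
    ⟨div_nonneg (by linarith [hy.1]) hl, (div_le_one hl').2 (by linarith [hy.2])⟩
  push_cast at h1 h2
  have hp : (0 : ℝ) < 2 ^ K := by positivity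
  have hyl : y = a + l * ((y - a) / l) := by field_simp; ring
  have hlow : a + l * (k / 2 ^ K) ≤ y := by
    rw [hyl]
    refine add_le_add_right (mul_le_mul_of_nonneg_left ?_ hl) a
    rw [div_le_iff₀ hp]; linarith
  have hup : y ≤ a + l * ((k + 1 : ℕ) / 2 ^ K) := by
    rw [hyl]
    refine add_le_add_right (mul_le_mul_of_nonneg_left ?_ hl) a
    rw [le_div_iff₀ hp]; push_cast; linarith
  have hw : a + l * ((k + 1 : ℕ) / 2 ^ K) - (a + l * (k / 2 ^ K)) = l / 2 ^ K := by
    push_cast; field_simp; ring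
  -- The left grid point bounds `E y` from below and the right one from above, so the one-sided
  -- bound is enough.
  have e1 := hE _ _ hlow
  have e2 := hE _ _ hup
  have g1 := hgrid K le_rfl k hk.le
  have g2 := hgrid K le_rfl (k + 1) hk
  have m1 : C * (y - (a + l * (k / 2 ^ K))) ≤ C * (l / 2 ^ K) :=
    mul_le_mul_of_nonneg_left (by linarith) hC
  have m2 : C * (a + l * ((k + 1 : ℕ) / 2 ^ K) - y) ≤ C * (l / 2 ^ K) :=
    mul_le_mul_of_nonneg_left (by linarith) hC
  rw [abs_le] at *
  constructor <;> linarith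

/-! ### Maximal exponential inequalities -/

/-- Doob's maximal inequality for the partial products of independent nonnegative bounded variables
with means at least `1`. -/
lemma measure_exists_prod_ge_le [IsProbabilityMeasure P] {W : ℕ → Ω → ℝ}
    (hW : ∀ i, Measurable (W i)) (hind : iIndepFun W P) {C : ℝ}
    (h0 : ∀ i ω, 0 ≤ W i ω) (hC : ∀ i ω, W i ω ≤ C) (h1 : ∀ i, 1 ≤ ∫ ω, W i ω ∂P)
    {c : ℝ} (hc : 0 < c) (N : ℕ) :
    P {ω | ∃ n < N, c ≤ ∏ i ∈ Finset.range (n + 1), W i ω}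
      ≤ ENNReal.ofReal ((∏ i ∈ Finset.range N, ∫ ω, W i ω ∂P) / c) := by
  rcases Nat.eq_zero_or_pos N with rfl | hN
  · simp
  have hWs : ∀ i, StronglyMeasurable (W i) := fun i => (hW i).stronglyMeasurable
  set F := Filtration.natural W hWs with hF
  set M : ℕ → Ω → ℝ := fun n => ∏ i ∈ Finset.range (n + 1), W i with hM
  have hMapp : ∀ n ω, M n ω = ∏ i ∈ Finset.range (n + 1), W i ω := fun n ω => by
    rw [hM]; exact Finset.prod_apply _ _ _
  have hM0 : ∀ n ω, 0 ≤ M n ω := fun n ω => by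
    rw [hMapp]; exact Finset.prod_nonneg fun i _ => h0 i ω
  have hint1 : ∀ i, Integrable (W i) P := fun i =>
    Integrable.of_bound (hWs i).aestronglyMeasurable C
      (ae_of_all _ fun ω => by rw [Real.norm_of_nonneg (h0 i ω)]; exact hC i ω)
  have hint : ∀ n, Integrable (M n) P := fun n => by
    refine Integrable.of_bound
      (Finset.stronglyMeasurable_prod _ fun i _ => hWs i).aestronglyMeasurable (C ^ (n + 1))
      (ae_of_all _ fun ω => ?_)
    rw [Real.norm_of_nonneg (hM0 n ω), hMapp]
    refine (Finset.prod_le_prod (fun i _ => h0 i ω) fun i _ => hC i ω).trans ?_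
    simp
  have hadp : StronglyAdapted F M := fun n =>
    Finset.stronglyMeasurable_prod _ fun i hi =>
      ((Filtration.stronglyAdapted_natural hWs) i).mono
        (F.mono (Nat.lt_succ_iff.1 (Finset.mem_range.1 hi)))
  have hsub : Submartingale M F P := by
    refine submartingale_nat hadp hint fun n => ?_
    have hMs : M (n + 1) = M n * W (n + 1) := by
      simp only [hM]; rw [Finset.prod_range_succ]
    have e1 := condExp_mul_of_stronglyMeasurable_left (μ := P) (m := F n) (hadp n)
      (by rw [← hMs]; exact hint (n + 1)) (hint1 (n + 1))
    have e2 := iIndepFun.condExp_natural_ae_eq_of_lt hWs hind (Nat.lt_succ_self n)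
    rw [hMs]
    filter_upwards [e1, e2] with ω w1 w2
    rw [w1, Pi.mul_apply]
    have w2' : (P[W (n + 1)|F n]) ω = ∫ ω, W (n + 1) ω ∂P := w2
    rw [w2']
    exact le_mul_of_one_le_right (hM0 n ω) (h1 _)
  have hmax := maximal_ineq (μ := P) hsub (fun n ω => hM0 n ω) (ε := c.toNNReal) (N - 1)
  have hN1 : N - 1 + 1 = N := by omega
  rw [Real.coe_toNNReal _ hc.le] at hmax
  have hset : {ω | ∃ n < N, c ≤ ∏ i ∈ Finset.range (n + 1), W i ω}
      ⊆ {ω | c ≤ (Finset.range (N - 1 + 1)).sup' Finset.nonempty_range_add_one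
        fun k => M k ω} := by
    rintro ω ⟨n, hn, h⟩
    rw [← hMapp] at h
    exact h.trans (Finset.le_sup' (fun k => M k ω) (by rw [Finset.mem_range]; omega))
  have hprod : ∫ ω, M (N - 1) ω ∂P = ∏ i ∈ Finset.range N, ∫ ω, W i ω ∂P := by
    simp only [hMapp, hN1]
    have := hind.precomp (g := fun i : Finset.range N => (i : ℕ)) Subtype.val_injective
    rw [← Finset.prod_coe_sort, ← iIndepFun.integral_fun_prod_eq_prod_integral this
      fun i => (hWs i).aestronglyMeasurable]
    refine integral_congr_ae (ae_of_all _ fun ω => ?_)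
    simp only
    rw [← Finset.prod_coe_sort]
  rw [ENNReal.ofReal_div_of_pos hc, ENNReal.le_div_iff_mul_le (Or.inl (by simpa using hc))
    (Or.inl ENNReal.ofReal_ne_top), mul_comm]
  refine (mul_le_mul_right (measure_mono hset) _).trans (hmax.trans (ENNReal.ofReal_le_ofReal ?_))
  rw [← hprod]
  exact setIntegral_le_integral (hint _) (ae_of_all _ (hM0 _))

/-- The cubic Taylor remainder is absorbed into the quadratic term. The coefficient tends to the
Gaussian value `1 / 2` as `l → 0`, as the sharp constant requires. -/
lemma exp_le_quadratic {x l : ℝ} (hl : l ≤ 1) (hx : |x| ≤ l) :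
    Real.exp x ≤ 1 + x + x ^ 2 / 2 * (1 + l) := by
  have h := Real.exp_bound (hx.trans hl) (n := 3) (by norm_num)
  have h' := (abs_le.1 h).2
  simp only [Finset.sum_range_succ, Finset.sum_range_zero, Nat.factorial] at h'
  norm_num at h'
  have h3 : |x| ^ 3 ≤ x ^ 2 * l := by
    rw [← sq_abs x, pow_succ]
    exact mul_le_mul_of_nonneg_left hx (by positivity)
  nlinarith [sq_nonneg x, abs_nonneg x, pow_nonneg (abs_nonneg x) 3]

/-- Bernstein-type maximal inequality for sums of bounded independent variables. -/
lemma measure_exists_sum_ge_le [IsProbabilityMeasure P] {Y : ℕ → Ω → ℝ}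
    (hY : ∀ i, Measurable (Y i)) (hind : iIndepFun Y P) (hY1 : ∀ i ω, |Y i ω| ≤ 1)
    {μ q : ℝ} (hμ : ∀ i, ∫ ω, Y i ω ∂P = μ) (hq : ∀ i, ∫ ω, Y i ω ^ 2 ∂P = q)
    {x l : ℝ} (hx : 0 < x) (hl0 : 0 ≤ l) (hl1 : l ≤ 1) (N : ℕ) :
    P {ω | ∃ n ≤ N, x ≤ ∑ i ∈ Finset.range n, (Y i ω - μ)}
      ≤ ENNReal.ofReal (Real.exp (-(l * x) + N * (l ^ 2 / 2 * (1 + l) * q))) := by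
  set W : ℕ → Ω → ℝ := fun i ω => Real.exp (l * (Y i ω - μ)) with hW
  have hYint : ∀ i, Integrable (Y i) P := fun i =>
    Integrable.of_bound (hY i).aestronglyMeasurable 1 (ae_of_all _ (hY1 i))
  have hY2int : ∀ i, Integrable (fun ω => Y i ω ^ 2) P := fun i =>
    Integrable.of_bound ((hY i).pow_const 2).aestronglyMeasurable 1 (ae_of_all _ fun ω => by
      rw [norm_pow]; exact pow_le_one₀ (norm_nonneg _) (hY1 i ω))
  have hWm : ∀ i, Measurable (W i) := fun i => by
    have := hY i
    fun_prop
  have hWind : iIndepFun W P :=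
    hind.comp (fun _ y => Real.exp (l * (y - μ))) fun i => by fun_prop
  have hWC : ∀ i ω, W i ω ≤ Real.exp (l * (1 - μ)) := fun i ω =>
    Real.exp_le_exp.2 (mul_le_mul_of_nonneg_left (by linarith [(abs_le.1 (hY1 i ω)).2]) hl0)
  have hWint : ∀ i, Integrable (W i) P := fun i =>
    Integrable.of_bound (hWm i).aestronglyMeasurable _
      (ae_of_all _ fun ω => by
        rw [Real.norm_of_nonneg (Real.exp_pos _).le]; exact hWC i ω)
  have h1 : ∀ i, 1 ≤ ∫ ω, W i ω ∂P := fun i => by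
    have : ∫ ω, (1 + l * (Y i ω - μ)) ∂P = 1 := by
      have hi : Integrable (fun ω => Y i ω - μ) P := (hYint i).sub (integrable_const _)
      rw [integral_add (integrable_const _) (hi.const_mul _),
        integral_const_mul, integral_sub (hYint i) (integrable_const _), hμ]
      simp
    rw [← this]
    refine integral_mono ((integrable_const _).add
      (((hYint i).sub (integrable_const _)).const_mul _)) (hWint i) fun ω => ?_
    have := Real.add_one_le_exp (l * (Y i ω - μ))
    simp only [hW]
    linarith
  -- The quadratic bound is applied to the uncentred `l * Y`, which satisfies `|l * Y| ≤ l`; the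
  -- mean then cancels against `exp (-(l * μ))`, leaving the raw second moment `q`.
  have h2 : ∀ i, ∫ ω, W i ω ∂P ≤ Real.exp (l ^ 2 / 2 * (1 + l) * q) := fun i => by
    have hb : ∀ ω, W i ω ≤ Real.exp (-(l * μ)) *
        (1 + l * Y i ω + l ^ 2 / 2 * (1 + l) * Y i ω ^ 2) := fun ω => by
      have e : W i ω = Real.exp (-(l * μ)) * Real.exp (l * Y i ω) := by
        rw [← Real.exp_add]; simp only [hW]; congr 1; ring
      rw [e]
      refine mul_le_mul_of_nonneg_left ?_ (Real.exp_pos _).le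
      have := exp_le_quadratic hl1 (x := l * Y i ω) (by
        rw [abs_mul, abs_of_nonneg hl0]
        exact mul_le_of_le_one_right hl0 (hY1 i ω))
      linarith [this]
    have hI1 : Integrable (fun ω => 1 + l * Y i ω) P :=
      (integrable_const _).add ((hYint i).const_mul _)
    have hI2 : Integrable (fun ω => l ^ 2 / 2 * (1 + l) * Y i ω ^ 2) P := (hY2int i).const_mul _
    refine (integral_mono (hWint i) ((hI1.add hI2).const_mul _) hb).trans ?_
    rw [integral_const_mul]
    simp only [Pi.add_apply]
    rw [integral_add hI1 hI2, integral_add (integrable_const _) ((hYint i).const_mul _),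
      integral_const_mul, integral_const_mul, hμ, hq]
    simp only [integral_const, probReal_univ, smul_eq_mul, one_mul]
    have e3 := Real.add_one_le_exp (l * μ + l ^ 2 / 2 * (1 + l) * q)
    calc _ ≤ Real.exp (-(l * μ)) * Real.exp (l * μ + l ^ 2 / 2 * (1 + l) * q) :=
          mul_le_mul_of_nonneg_left (by linarith) (Real.exp_pos _).le
      _ = _ := by rw [← Real.exp_add]; congr 1; ring
  have hsub : {ω | ∃ n ≤ N, x ≤ ∑ i ∈ Finset.range n, (Y i ω - μ)}
      ⊆ {ω | ∃ n < N, Real.exp (l * x) ≤ ∏ i ∈ Finset.range (n + 1), W i ω} := by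
    rintro ω ⟨n, hn, h⟩
    -- The empty sum is `0 < x`, so `n = 0` cannot occur and the partial products may start with one
    -- factor.
    obtain ⟨n, rfl⟩ : ∃ n', n = n' + 1 := by
      refine ⟨n - 1, ?_⟩
      rcases Nat.eq_zero_or_pos n with rfl | h0
      · simp at h; linarith
      · omega
    refine ⟨n, by omega, ?_⟩
    simp only [hW]
    rw [← Real.exp_sum, ← Finset.mul_sum]
    exact Real.exp_le_exp.2 (mul_le_mul_of_nonneg_left h hl0)
  refine (measure_mono hsub).trans ((measure_exists_prod_ge_le hWm hWind
    (fun i ω => (Real.exp_pos _).le) hWC h1 (Real.exp_pos _) N).trans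
    (ENNReal.ofReal_le_ofReal ?_))
  rw [Real.exp_add, Real.exp_neg, div_eq_inv_mul]
  refine mul_le_mul_of_nonneg_left ?_ (inv_nonneg.2 (Real.exp_pos _).le)
  refine (Finset.prod_le_prod (fun i _ => zero_le_one.trans (h1 i)) fun i _ => h2 i).trans ?_
  rw [Finset.prod_const, Finset.card_range, ← Real.exp_nat_mul]

/-! ### Exponential bounds for empirical increments -/

/-- The uniform law gives to a subinterval of `[0,1]` its length. -/
lemma integral_indicator_Ioc {X : Ω → ℝ} (hX : Measurable X)
    (hu : pdf.IsUniform X (Icc (0 : ℝ) 1) P volume) {a b : ℝ} (h0 : 0 ≤ a) (hab : a ≤ b)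
    (h1 : b ≤ 1) : ∫ ω, (Ioc a b).indicator (1 : ℝ → ℝ) (X ω) ∂P = b - a := by
  have hm : P (X ⁻¹' Ioc a b) = ENNReal.ofReal (b - a) := by
    have hs : Ioc a b ⊆ Icc 0 1 := fun y hy => ⟨h0.trans hy.1.le, hy.2.trans h1⟩
    rw [hu.measure_preimage (by simp) (by simp) measurableSet_Ioc, inter_eq_right.2 hs]
    simp
  have he : (fun ω => (Ioc a b).indicator (1 : ℝ → ℝ) (X ω))
      = (X ⁻¹' Ioc a b).indicator 1 := by
    ext ω; rfl
  rw [he, integral_indicator_one (hX measurableSet_Ioc), measureReal_def, hm,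
    ENNReal.toReal_ofReal (by linarith)]

/-- Maximal exponential bound for linear combinations of increments of the centred counting process
over consecutive intervals. -/
lemma measure_exists_increments_ge_le [IsProbabilityMeasure P] {U : ℕ → Ω → ℝ}
    (hU : ∀ i, Measurable (U i)) (hind : iIndepFun U P)
    (hunif : ∀ i, pdf.IsUniform (U i) (Icc (0 : ℝ) 1) P volume)
    {m : ℕ} {v : ℕ → ℝ} (hv : ∀ j < m, |v j| ≤ 1) {a d : ℝ} (ha : 0 ≤ a) (hd : 0 ≤ d)
    (h1 : a + m * d ≤ 1) {x l : ℝ} (hx : 0 < x) (hl0 : 0 ≤ l) (hl1 : l ≤ 1) (N : ℕ) :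
    P {ω | ∃ n ≤ N, x ≤ ∑ j ∈ Finset.range m, v j *
        (centredCount (fun i => U i ω) n (a + (j + 1 : ℕ) * d)
          - centredCount (fun i => U i ω) n (a + j * d))}
      ≤ ENNReal.ofReal (Real.exp (-(l * x)
          + N * (l ^ 2 / 2 * (1 + l) * (d * ∑ j ∈ Finset.range m, v j ^ 2)))) := by
  set I : ℕ → Set ℝ := fun j => Ioc (a + j * d) (a + (j + 1 : ℕ) * d) with hI
  -- The combination of increments is the centred sum of `f (U i)`, where the step function `f`
  -- equals `v j` on the `j`th cell; disjointness of the cells gives the second moment `d * ∑ v j ^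
  -- 2`.
  set f : ℝ → ℝ := fun y => ∑ j ∈ Finset.range m, v j * (I j).indicator 1 y with hf
  have hle : ∀ j : ℕ, a + j * d ≤ a + (j + 1 : ℕ) * d := fun j => by push_cast; nlinarith
  have hlen : ∀ j : ℕ, a + (j + 1 : ℕ) * d - (a + j * d) = d := fun j => by push_cast; ring
  have hdisj : ∀ i j, ∀ y, y ∈ I i → y ∈ I j → i = j := by
    have key : ∀ i j : ℕ, ∀ y, y ∈ I i → y ∈ I j → ¬ i < j := by
      intro i j y hi hj hij
      have h' : ((i + 1 : ℕ) : ℝ) ≤ j := by exact_mod_cast hij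
      have := hi.2.trans (by nlinarith : a + ((i + 1 : ℕ) : ℝ) * d ≤ a + j * d)
      exact absurd hj.1 (not_lt.2 this)
    intro i j y hi hj
    exact le_antisymm (not_lt.1 (key j i y hj hi)) (not_lt.1 (key i j y hi hj))
  have hfcell : ∀ y, ∀ j < m, y ∈ I j → f y = v j := by
    intro y j hj hy
    simp only [hf]
    rw [Finset.sum_eq_single j]
    · simp [hy]
    · intro i _ hij
      rw [indicator_of_notMem fun h => hij (hdisj _ _ y h hy), mul_zero]
    · intro h; exact absurd (Finset.mem_range.2 hj) h
  have hfout : ∀ y, (∀ j < m, y ∉ I j) → f y = 0 := fun y hy =>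
    Finset.sum_eq_zero fun j hj => by
      rw [indicator_of_notMem (hy j (Finset.mem_range.1 hj)), mul_zero]
  have hfm : Measurable f := by
    refine Finset.measurable_sum _ fun j _ => ?_
    exact (measurable_one.indicator measurableSet_Ioc).const_mul _
  have hf1 : ∀ y, |f y| ≤ 1 := by
    intro y
    by_cases h : ∃ j < m, y ∈ I j
    · obtain ⟨j, hj, hy⟩ := h
      rw [hfcell y j hj hy]; exact hv j hj
    · push Not at h
      rw [hfout y h]; simp
  have hf2 : ∀ y, f y ^ 2 = ∑ j ∈ Finset.range m, v j ^ 2 * (I j).indicator 1 y := by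
    intro y
    by_cases h : ∃ j < m, y ∈ I j
    · obtain ⟨j, hj, hy⟩ := h
      rw [hfcell y j hj hy, Finset.sum_eq_single j]
      · simp [hy]
      · intro i _ hij
        rw [indicator_of_notMem fun h => hij (hdisj _ _ y h hy), mul_zero]
      · intro h; exact absurd (Finset.mem_range.2 hj) h
    · push Not at h
      rw [hfout y h, Finset.sum_eq_zero]
      · norm_num
      · intro j hj
        rw [indicator_of_notMem (h j (Finset.mem_range.1 hj)), mul_zero]
  have hIint : ∀ i, ∀ j < m, ∫ ω, (I j).indicator (1 : ℝ → ℝ) (U i ω) ∂P = d := by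
    intro i j hj
    have h' : ((j + 1 : ℕ) : ℝ) ≤ m := by exact_mod_cast hj
    rw [integral_indicator_Ioc (hU i) (hunif i) (by positivity) (hle j) (by nlinarith), hlen]
  have hlin : ∀ (w : ℕ → ℝ) (i : ℕ), ∫ ω, ∑ j ∈ Finset.range m,
      w j * (I j).indicator (1 : ℝ → ℝ) (U i ω) ∂P = d * ∑ j ∈ Finset.range m, w j := by
    intro w i
    rw [integral_finsetSum]
    · rw [Finset.mul_sum]
      refine Finset.sum_congr rfl fun j hj => ?_
      rw [integral_const_mul, hIint i j (Finset.mem_range.1 hj), mul_comm]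
    · intro j _
      refine Integrable.const_mul (Integrable.of_bound (C := 1)
        ((measurable_one.indicator measurableSet_Ioc).comp (hU i)).aestronglyMeasurable
        (ae_of_all _ fun ω => ?_)) _
      refine (norm_indicator_le_norm_self _ _).trans ?_
      simp
  have key := measure_exists_sum_ge_le (P := P) (Y := fun i ω => f (U i ω))
    (fun i => hfm.comp (hU i)) (hind.comp (fun _ => f) fun _ => hfm) (fun i ω => hf1 _)
    (fun i => hlin v i) (q := d * ∑ j ∈ Finset.range m, v j ^ 2)
    (fun i => by simp only [hf2]; exact hlin (fun j => v j ^ 2) i) hx hl0 hl1 N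
  refine le_trans (measure_mono ?_) key
  rintro ω ⟨n, hn, h⟩
  refine ⟨n, hn, h.trans_eq ?_⟩
  simp only [centredCount_sub _ n (hle _), hlen, hf, Finset.mul_sum]
  rw [Finset.sum_comm]
  refine Finset.sum_congr rfl fun i _ => ?_
  rw [← Finset.sum_sub_distrib]
  exact Finset.sum_congr rfl fun j _ => by ring

/-- One cell with both signs. No sharp constant is needed here, so `(1 + l) / 2` is replaced by `1`.
-/
lemma measureReal_exists_abs_increment_ge_le [IsProbabilityMeasure P] {U : ℕ → Ω → ℝ}
    (hU : ∀ i, Measurable (U i)) (hind : iIndepFun U P)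
    (hunif : ∀ i, pdf.IsUniform (U i) (Icc (0 : ℝ) 1) P volume)
    {a d : ℝ} (ha : 0 ≤ a) (hd : 0 ≤ d) (h1 : a + d ≤ 1) {x l : ℝ} (hx : 0 < x) (hl0 : 0 ≤ l)
    (hl1 : l ≤ 1) (N : ℕ) :
    P.real {ω | ∃ n ≤ N, x ≤ |centredCount (fun i => U i ω) n (a + d)
          - centredCount (fun i => U i ω) n a|}
      ≤ 2 * Real.exp (-(l * x) + N * (l ^ 2 * d)) := by
  have key : ∀ s : ℝ, |s| = 1 → P.real {ω | ∃ n ≤ N, x ≤ s *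
      (centredCount (fun i => U i ω) n (a + d) - centredCount (fun i => U i ω) n a)}
      ≤ Real.exp (-(l * x) + N * (l ^ 2 * d)) := by
    intro s hs
    have h := measure_exists_increments_ge_le (P := P) hU hind hunif (m := 1) (v := fun _ => s)
      (fun _ _ => hs.le) ha hd (by simpa using h1) hx hl0 hl1 N
    simp only [Finset.sum_range_one] at h
    norm_num at h
    refine ENNReal.toReal_le_of_le_ofReal (Real.exp_pos _).le
      (h.trans (ENNReal.ofReal_le_ofReal (Real.exp_le_exp.2 ?_)))
    have hs2 : s ^ 2 = 1 := by rw [← sq_abs, hs]; norm_num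
    rw [hs2, mul_one]
    have : l ^ 2 / 2 * (1 + l) * d ≤ l ^ 2 * d :=
      mul_le_mul_of_nonneg_right (by nlinarith [sq_nonneg l]) hd
    have := mul_le_mul_of_nonneg_left this N.cast_nonneg (α := ℝ)
    linarith
  have hsub : {ω | ∃ n ≤ N, x ≤ |centredCount (fun i => U i ω) n (a + d)
        - centredCount (fun i => U i ω) n a|}
      ⊆ {ω | ∃ n ≤ N, x ≤ 1 *
      (centredCount (fun i => U i ω) n (a + d) - centredCount (fun i => U i ω) n a)} ∪
      {ω | ∃ n ≤ N, x ≤ -1 *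
      (centredCount (fun i => U i ω) n (a + d) - centredCount (fun i => U i ω) n a)} := by
    rintro ω ⟨n, hn, h⟩
    rcases le_abs.1 h with h | h
    · exact Or.inl ⟨n, hn, by rwa [one_mul]⟩
    · exact Or.inr ⟨n, hn, by rwa [neg_one_mul]⟩
  refine (measureReal_mono hsub).trans ((measureReal_union_le _ _).trans ?_)
  rw [two_mul]
  exact add_le_add (key 1 (by simp)) (key (-1) (by simp))

/-- Exponential bound for the oscillation of the centred counting process over a short interval,
uniformly in the sample size. -/
lemma measureReal_exists_osc_gt_le [IsProbabilityMeasure P] {U : ℕ → Ω → ℝ}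
    (hU : ∀ i, Measurable (U i)) (hind : iIndepFun U P)
    (hunif : ∀ i, pdf.IsUniform (U i) (Icc (0 : ℝ) 1) P volume)
    {ε δ h L a : ℝ} {N : ℕ} (hε : 0 < ε) (hδ : 0 < δ) (hδε : δ * 6144 ≤ ε ^ 2) (hh : 0 < h)
    (hN : 0 < N) (hL : 1 ≤ L) (ha : 0 ≤ a) (ha1 : a + δ * h ≤ 1)
    (hbig : ε * L ≤ 2 * δ * √(N * h * L)) :
    P.real {ω | ∃ n ≤ N, ∃ y ∈ Icc a (a + δ * h), ε * √(N * h * L) <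
        |centredCount (fun i => U i ω) n y - centredCount (fun i => U i ω) n a|}
      ≤ 4 * Real.exp (-(3 * L)) := by
  have hN' : (0 : ℝ) < N := by exact_mod_cast hN
  have hL0 : 0 < L := by linarith
  set σ := √(N * h * L) with hσ
  have hσ0 : 0 < σ := by positivity
  have hσ2 : σ ^ 2 = N * h * L := Real.sq_sqrt (by positivity)
  -- `2 ^ K` lies between `2 δ σ / (ε L)` and twice it: large enough for the one-sided remainder to
  -- be at most `ε σ / 2`, small enough for every tilt `l k` to be at most `1`.
  obtain ⟨K', hK1, hK2⟩ := exists_nat_pow_near (x := 2 * δ * σ / (ε * L)) (y := 2)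
    ((one_le_div (by positivity)).2 hbig) one_lt_two
  set K := K' + 1 with hK
  have hKu : (2 : ℝ) ^ K ≤ 4 * δ * σ / (ε * L) := by
    rw [hK, pow_succ]
    calc _ ≤ 2 * δ * σ / (ε * L) * 2 := mul_le_mul_of_nonneg_right hK1 (by norm_num)
      _ = _ := by ring
  -- The thresholds sum to at most `ε σ / 2`. The tilts give `l k * x k = 48 L (9/8) ^ k`, and `hδε`
  -- keeps the variance term below half of this. The remaining exponent, at least `24 L + 3 L k`,
  -- outweighs the `2 ^ k` intervals of level `k`.
  set x : ℕ → ℝ := fun k => ε / 8 * (3 / 4) ^ k * σ with hx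
  set l : ℕ → ℝ := fun k => 384 / ε * (L / σ) * (3 / 2) ^ k with hl
  set B : ℕ → ℕ → Set Ω := fun k i => {ω | ∃ n ≤ N, x k ≤
    |centredCount (fun i => U i ω) n (a + δ * h * (i / 2 ^ k) + δ * h / 2 ^ k)
      - centredCount (fun i => U i ω) n (a + δ * h * (i / 2 ^ k))|} with hB
  have hsplit : ∀ (k i : ℕ), a + δ * h * (i / 2 ^ k) + δ * h / 2 ^ k
      = a + δ * h * ((i + 1 : ℕ) / 2 ^ k) := by
    intro k i; push_cast; ring
  have hBle : ∀ k ≤ K, ∀ i < 2 ^ k,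
      P.real (B k i) ≤ 2 * (Real.exp (-(3 * L)) * (1 / 4) ^ k) := by
    intro k hk i hi
    have hp : (0 : ℝ) < 2 ^ k := by positivity
    have hlk : l k ≤ 1 := by
      have : (3 / 2 : ℝ) ^ k ≤ 4 * δ * σ / (ε * L) := by
        refine le_trans ?_ ((pow_le_pow_right₀ one_le_two hk).trans hKu)
        gcongr; norm_num
      calc l k ≤ 384 / ε * (L / σ) * (4 * δ * σ / (ε * L)) :=
            mul_le_mul_of_nonneg_left this (by positivity)
        _ = δ * 6144 / (4 * ε ^ 2) := by field_simp; norm_num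
        _ ≤ 1 := by rw [div_le_one (by positivity)]; nlinarith [sq_nonneg ε]
    have hi1 : ((i + 1 : ℕ) : ℝ) / 2 ^ k ≤ 1 := by
      rw [div_le_one hp]; exact_mod_cast hi
    have hend : a + δ * h * (i / 2 ^ k) + δ * h / 2 ^ k ≤ 1 := by
      rw [hsplit]
      have : δ * h * (((i + 1 : ℕ) : ℝ) / 2 ^ k) ≤ δ * h :=
        mul_le_of_le_one_right (by positivity) hi1
      linarith
    refine (measureReal_exists_abs_increment_ge_le hU hind hunif (x := x k) (l := l k)
      (by positivity) (by positivity) hend (by positivity) (by positivity) hlk N).trans ?_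
    refine mul_le_mul_of_nonneg_left ?_ zero_le_two
    have h1 : l k * x k = 48 * L * (9 / 8) ^ k := by
      have : (9 / 8 : ℝ) ^ k = (3 / 2) ^ k * (3 / 4) ^ k := by rw [← mul_pow]; norm_num
      simp only [hl, hx]
      rw [this]
      field_simp
      norm_num
    have h2 : N * (l k ^ 2 * (δ * h / 2 ^ k)) ≤ 24 * L * (9 / 8) ^ k := by
      have e1 : (9 / 8 : ℝ) ^ k = ((3 / 2) ^ k) ^ 2 / 2 ^ k := by
        rw [← pow_mul, mul_comm k 2, pow_mul, ← div_pow]; norm_num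
      have e2 : N * (l k ^ 2 * (δ * h / 2 ^ k))
          = δ * 6144 / ε ^ 2 * (24 * L * (9 / 8) ^ k) := by
        rw [e1]
        simp only [hl]
        have : (384 / ε * (L / σ) * (3 / 2 : ℝ) ^ k) ^ 2
          = 384 ^ 2 / ε ^ 2 * (L ^ 2 / σ ^ 2) * ((3 / 2 : ℝ) ^ k) ^ 2 := by ring
        rw [this, hσ2]
        field_simp
        norm_num
      rw [e2]
      exact mul_le_of_le_one_left (by positivity) ((div_le_one (by positivity)).2 hδε)
    have h3 : 1 + (k : ℝ) / 8 ≤ (9 / 8) ^ k := by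
      have := one_add_mul_le_pow (a := (1 / 8 : ℝ)) (by norm_num) k
      norm_num at this ⊢
      linarith
    have h4 : Real.exp (-3) ≤ 1 / 4 := by
      rw [Real.exp_neg, inv_le_comm₀ (Real.exp_pos _) (by norm_num)]
      have := Real.add_one_le_exp (3 : ℝ)
      norm_num at this ⊢
      linarith
    calc _ ≤ Real.exp (-(3 * L) + k * (-3)) := by
          refine Real.exp_le_exp.2 ?_
          rw [h1]
          have h5 : 24 * L * (1 + (k : ℝ) / 8) ≤ 24 * L * (9 / 8) ^ k :=
            mul_le_mul_of_nonneg_left h3 (by positivity)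
          have h6 : (k : ℝ) ≤ L * k := le_mul_of_one_le_left k.cast_nonneg hL
          nlinarith
      _ = Real.exp (-(3 * L)) * Real.exp (-3) ^ k := by rw [Real.exp_add, Real.exp_nat_mul]
      _ ≤ _ := by gcongr
  have hsub : {ω | ∃ n ≤ N, ∃ y ∈ Icc a (a + δ * h), ε * σ <
        |centredCount (fun i => U i ω) n y - centredCount (fun i => U i ω) n a|}
      ⊆ ⋃ k ∈ Finset.range (K + 1), ⋃ i ∈ Finset.range (2 ^ k), B k i := by
    rintro ω ⟨n, hn, y, hy, hlt⟩
    by_contra hcon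
    simp only [mem_iUnion, not_exists, Finset.mem_range, hB, mem_ofPred_eq, not_and, not_le,
      hsplit] at hcon
    have hch := abs_sub_le_of_dyadic (E := centredCount (fun i => U i ω) n) (C := n)
      (l := δ * h) (by positivity) n.cast_nonneg
      (fun y z hyz => centredCount_sub_ge _ n hyz) (x := x) (K := K)
      (fun k hk i hi => (hcon k (Nat.lt_succ_of_le hk) i hi n hn).le) hy
    have hs1 : ∑ k ∈ Finset.range (K + 1), x k ≤ ε / 2 * σ := by
      have hg : ∑ k ∈ Finset.range (K + 1), (3 / 4 : ℝ) ^ k ≤ 4 := by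
        rw [geom_sum_eq (by norm_num)]
        have : (0 : ℝ) ≤ (3 / 4) ^ (K + 1) := by positivity
        rw [div_le_iff_of_neg (by norm_num)]
        linarith
      calc _ = ε / 8 * σ * ∑ k ∈ Finset.range (K + 1), (3 / 4 : ℝ) ^ k := by
            rw [Finset.mul_sum]; exact Finset.sum_congr rfl fun k _ => by simp only [hx]; ring
        _ ≤ ε / 8 * σ * 4 := mul_le_mul_of_nonneg_left hg (by positivity)
        _ = _ := by ring
    have hs2 : (n : ℝ) * (δ * h / 2 ^ K) ≤ ε / 2 * σ := by
      have hnN : (n : ℝ) ≤ N := by exact_mod_cast hn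
      have h3 : δ * h / 2 ^ K ≤ δ * h / (2 * δ * σ / (ε * L)) := by
        gcongr
      calc (n : ℝ) * (δ * h / 2 ^ K) ≤ N * (δ * h / (2 * δ * σ / (ε * L))) := by gcongr
        _ = ε / 2 * ((N * h * L) / σ) := by field_simp
        _ = _ := by rw [← hσ2]; field_simp
    linarith
  refine (measureReal_mono hsub (measure_ne_top _ _)).trans ((measureReal_biUnion_finset_le _ _).trans ?_)
  have hstep : ∀ k ∈ Finset.range (K + 1), P.real (⋃ i ∈ Finset.range (2 ^ k), B k i)
      ≤ 2 * Real.exp (-(3 * L)) * (1 / 2) ^ k := by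
    intro k hk
    refine (measureReal_biUnion_finset_le _ _).trans ((Finset.sum_le_sum fun i hi =>
      hBle k (Nat.lt_succ_iff.1 (Finset.mem_range.1 hk)) i (Finset.mem_range.1 hi)).trans_eq ?_)
    have : (1 / 2 : ℝ) ^ k = 2 ^ k * (1 / 4) ^ k := by rw [← mul_pow]; norm_num
    rw [Finset.sum_const, Finset.card_range, nsmul_eq_mul, this]
    push_cast
    ring
  refine (Finset.sum_le_sum hstep).trans ?_
  rw [← Finset.mul_sum]
  have hg : ∑ k ∈ Finset.range (K + 1), (1 / 2 : ℝ) ^ k ≤ 2 := by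
    rw [geom_sum_eq (by norm_num)]
    have : (0 : ℝ) ≤ (1 / 2) ^ (K + 1) := by positivity
    rw [div_le_iff_of_neg (by norm_num)]
    linarith
  calc _ ≤ 2 * Real.exp (-(3 * L)) * 2 := mul_le_mul_of_nonneg_left hg (by positivity)
    _ = _ := by ring

/-- Exponential bound, with the sharp constant, for a linear combination of increments in the
direction of a unit vector. -/
lemma measureReal_exists_direction_ge_le [IsProbabilityMeasure P] {U : ℕ → Ω → ℝ}
    (hU : ∀ i, Measurable (U i)) (hind : iIndepFun U P)
    (hunif : ∀ i, pdf.IsUniform (U i) (Icc (0 : ℝ) 1) P volume)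
    {m N : ℕ} {v : ℕ → ℝ} (hv : ∑ j ∈ Finset.range m, v j ^ 2 = 1) {η h L a : ℝ}
    (hη0 : 0 < η) (hη1 : η ≤ 1) (hh : 0 < h) (hN : 0 < N) (hm : 0 < m) (hL : 0 < L) (ha : 0 ≤ a)
    (ha1 : a + h ≤ 1) (hbig : 4 * m * L ≤ η ^ 2 * (N * h)) :
    P.real {ω | ∃ n ≤ N, (1 + η) * (2 * √(N * h * L / m)) ≤ ∑ j ∈ Finset.range m, v j *
        (centredCount (fun i => U i ω) n (a + (j + 1 : ℕ) * (h / m))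
          - centredCount (fun i => U i ω) n (a + j * (h / m)))}
      ≤ Real.exp (-((2 + η) * L)) := by
  have hN' : (0 : ℝ) < N := by exact_mod_cast hN
  have hm' : (0 : ℝ) < m := by exact_mod_cast hm
  set s := √(N * h * L / m) with hs
  have hs0 : 0 < s := by positivity
  have hs2 : s ^ 2 = N * h * L / m := Real.sq_sqrt (by positivity)
  -- The Gaussian optimal tilt for threshold `2 * s` and variance `N h / m`. As `hbig` means `l ≤
  -- η`, the exponent is `-4 (1 + η) L + 2 (1 + l) L ≤ -(2 + 2 η) L`.
  set l := 2 * L / s with hl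
  have hl0 : 0 < l := by positivity
  have hl2 : l ^ 2 = 4 * m * L / (N * h) := by
    rw [hl, div_pow, hs2]; field_simp; norm_num
  have hlη : l ≤ η := by
    refine le_of_sq_le_sq ?_ hη0.le
    rw [hl2, div_le_iff₀ (by positivity)]
    exact hbig
  have hv1 : ∀ j < m, |v j| ≤ 1 := by
    intro j hj
    rw [← sq_le_one_iff_abs_le_one, ← hv]
    exact Finset.single_le_sum (f := fun j => v j ^ 2) (fun i _ => sq_nonneg _)
      (Finset.mem_range.2 hj)
  have key := measure_exists_increments_ge_le (P := P) hU hind hunif hv1 ha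
    (d := h / m) (by positivity) (by rwa [mul_div_cancel₀ _ hm'.ne'])
    (x := (1 + η) * (2 * s)) (by positivity) hl0.le (hlη.trans hη1) N
  refine ENNReal.toReal_le_of_le_ofReal (Real.exp_pos _).le
    (key.trans (ENNReal.ofReal_le_ofReal (Real.exp_le_exp.2 ?_)))
  have e1 : l * ((1 + η) * (2 * s)) = 4 * (1 + η) * L := by
    rw [hl]; field_simp; ring
  have e2 : (N : ℝ) * (l ^ 2 / 2 * (1 + l) * (h / m * 1)) = 2 * L * (1 + l) := by
    rw [hl2]; field_simp; ring
  rw [hv, e1, e2]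
  nlinarith

/-! ### Regularity at one scale and one sample size -/

/-- A finite family of unit vectors which detects the Euclidean norm up to a factor `1 + η`. -/
lemma exists_finset_directions (m : ℕ) {η : ℝ} (hη : 0 < η) :
    ∃ V : Finset (ℕ → ℝ), (∀ v ∈ V, ∑ j ∈ Finset.range m, v j ^ 2 = 1) ∧
      ∀ (x : ℕ → ℝ) (R : ℝ), 0 ≤ R → (∀ v ∈ V, ∑ j ∈ Finset.range m, v j * x j ≤ R) →
        ∑ j ∈ Finset.range m, x j ^ 2 ≤ ((1 + η) * R) ^ 2 := by
  classical
  -- With net radius `η / (1 + η)`, some net direction retains at least the fraction `1 / (1 + η)`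
  -- of the norm.
  obtain ⟨T, hT, hfin, hcov⟩ := finite_cover_balls_of_compact
    (isCompact_sphere (0 : EuclideanSpace ℝ (Fin m)) 1) (e := η / (1 + η)) (by positivity)
  set ext : EuclideanSpace ℝ (Fin m) → ℕ → ℝ := fun v j => if h : j < m then v ⟨j, h⟩ else 0
    with hext
  have hextj : ∀ (v : EuclideanSpace ℝ (Fin m)) (j : Fin m), ext v j = v j := by
    intro v j; simp [hext]
  refine ⟨hfin.toFinset.image ext, ?_, ?_⟩
  · intro v hv
    obtain ⟨w, hw, rfl⟩ := Finset.mem_image.1 hv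
    have hw1 : ‖w‖ = 1 := by simpa using hT (hfin.mem_toFinset.1 hw)
    rw [Finset.sum_range]
    simp only [hextj]
    rw [← EuclideanSpace.real_norm_sq_eq, hw1, one_pow]
  · intro x R hR hx
    set X : EuclideanSpace ℝ (Fin m) := WithLp.toLp 2 fun j => x j with hX
    have hXn : ∑ j ∈ Finset.range m, x j ^ 2 = ‖X‖ ^ 2 := by
      rw [Finset.sum_range, EuclideanSpace.real_norm_sq_eq]
    rw [hXn]
    refine pow_le_pow_left₀ (norm_nonneg _) ?_ 2
    rcases (norm_nonneg X).eq_or_lt with h0 | h0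
    · rw [← h0]; positivity
    have hu : ‖X‖⁻¹ • X ∈ Metric.sphere (0 : EuclideanSpace ℝ (Fin m)) 1 := by
      simp [norm_smul, h0.ne']
    obtain ⟨w, hw, hwb⟩ := mem_iUnion₂.1 (hcov hu)
    have h1 := hx (ext w) (Finset.mem_image_of_mem _ (hfin.mem_toFinset.2 hw))
    have h2 : ∑ j ∈ Finset.range m, ext w j * x j = inner ℝ w X := by
      rw [Finset.sum_range, PiLp.inner_apply]
      refine Finset.sum_congr rfl fun j _ => ?_
      rw [hextj]; simp [hX, mul_comm]
    rw [h2] at h1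
    have h3 : inner ℝ (‖X‖⁻¹ • X) X = ‖X‖ := by
      rw [real_inner_smul_left, real_inner_self_eq_norm_sq]
      field_simp
    have h4 : inner ℝ (‖X‖⁻¹ • X - w) X ≤ η / (1 + η) * ‖X‖ := by
      refine (real_inner_le_norm _ _).trans (mul_le_mul_of_nonneg_right ?_ h0.le)
      rw [← dist_eq_norm]; exact (Metric.mem_ball.1 hwb).le
    rw [inner_sub_left, h3] at h4
    have h5 : ‖X‖ = (1 + η) * (‖X‖ - η / (1 + η) * ‖X‖) := by field_simp; ring
    rw [h5]
    refine mul_le_mul_of_nonneg_left (by linarith) (by positivity)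

/-- The regularity event for the sample sizes `n ≤ N` at the scale `h`: small oscillations on the
cells of the mesh `h / m` and increments with controlled energy. -/
def RegularAt (u : ℕ → ℝ) (t ε η L : ℝ) (m N : ℕ) (h : ℝ) : Prop :=
  ∀ n ≤ N, (∀ j < m, ∀ y ∈ Icc (t + j * (h / m)) (t + (j + 1 : ℕ) * (h / m)),
      |centredCount u n y - centredCount u n (t + j * (h / m))| ≤ ε * √(N * h * L)) ∧
    ∑ j ∈ Finset.range m, (centredCount u n (t + (j + 1 : ℕ) * (h / m))
      - centredCount u n (t + j * (h / m))) ^ 2 ≤ ((1 + η) * ((1 + η) * (2 * √(N * h * L / m)))) ^ 2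

/-- A union bound over the net and the `m` cells; `C` and `c` do not depend on `N`, `h`, `L`. The
condition `hmε` is the chaining condition with `δ = 1 / m`. -/
lemma exists_measureReal_not_regularAt_le [IsProbabilityMeasure P] {U : ℕ → Ω → ℝ}
    (hU : ∀ i, Measurable (U i)) (hind : iIndepFun U P)
    (hunif : ∀ i, pdf.IsUniform (U i) (Icc (0 : ℝ) 1) P volume) {t ε η : ℝ} (ht : 0 ≤ t)
    (hε : 0 < ε) (hη0 : 0 < η) (hη1 : η ≤ 1) {m : ℕ} (hm : 0 < m) (hmε : 6144 ≤ m * ε ^ 2) :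
    ∃ C c : ℝ, 0 ≤ C ∧ 1 ≤ c ∧ ∀ (N : ℕ) (h L : ℝ), 0 < h → t + h ≤ 1 → 1 ≤ L → c * L ≤ N * h →
      P.real {ω | ¬ RegularAt (fun i => U i ω) t ε η L m N h} ≤ C * Real.exp (-((2 + η) * L)) := by
  have hm' : (0 : ℝ) < m := by exact_mod_cast hm
  obtain ⟨V, hV1, hV2⟩ := exists_finset_directions m hη0
  -- The summands of `c` serve, in order, to force `N > 0`, to stop the chaining late enough, and to
  -- keep the directional tilt below `η`.
  refine ⟨V.card + m * 4, 1 + ε ^ 2 * m ^ 2 / 4 + 4 * m / η ^ 2, by positivity, ?_, ?_⟩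
  · have : 0 ≤ ε ^ 2 * m ^ 2 / 4 + 4 * m / η ^ 2 := by positivity
    linarith
  intro N h L hh hth hL hc
  have hL0 : 0 < L := by linarith
  have hc1 : L + ε ^ 2 * m ^ 2 / 4 * L + 4 * m / η ^ 2 * L ≤ N * h := by linarith
  have p1 : 0 ≤ ε ^ 2 * m ^ 2 / 4 * L := by positivity
  have p2 : 0 ≤ 4 * m / η ^ 2 * L := by positivity
  have hN : 0 < N := by
    rcases Nat.eq_zero_or_pos N with rfl | h0
    · norm_num at hc1; linarith
    · exact h0
  have hN' : (0 : ℝ) < N := by exact_mod_cast hN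
  have hdir : 4 * m * L ≤ η ^ 2 * (N * h) := by
    have : 4 * m / η ^ 2 * L ≤ N * h := by linarith
    calc 4 * m * L = η ^ 2 * (4 * m / η ^ 2 * L) := by field_simp
      _ ≤ _ := mul_le_mul_of_nonneg_left this (by positivity)
  have hosc : ε * L ≤ 2 * (1 / m) * √(N * h * L) := by
    have h1 : ε * m * L / 2 ≤ √(N * h * L) := by
      refine Real.le_sqrt_of_sq_le ?_
      have : ε ^ 2 * m ^ 2 / 4 * L * L ≤ N * h * L :=
        mul_le_mul_of_nonneg_right (by linarith) hL0.le
      linarith [this]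
    calc ε * L = 2 * (1 / m) * (ε * m * L / 2) := by field_simp
      _ ≤ _ := mul_le_mul_of_nonneg_left h1 (by positivity)
  set A : (ℕ → ℝ) → Set Ω := fun v => {ω | ∃ n ≤ N, (1 + η) * (2 * √(N * h * L / m)) ≤
    ∑ j ∈ Finset.range m, v j * (centredCount (fun i => U i ω) n (t + (j + 1 : ℕ) * (h / m))
          - centredCount (fun i => U i ω) n (t + j * (h / m)))} with hA
  set B : ℕ → Set Ω := fun j => {ω | ∃ n ≤ N, ∃ y ∈ Icc (t + j * (h / m))
    (t + j * (h / m) + 1 / m * h), ε * √(N * h * L) < |centredCount (fun i => U i ω) n y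
      - centredCount (fun i => U i ω) n (t + j * (h / m))|} with hB
  have hend : ∀ j : ℕ, t + j * (h / m) + 1 / m * h = t + (j + 1 : ℕ) * (h / m) := by
    intro j; push_cast; ring
  have hsub : {ω | ¬ RegularAt (fun i => U i ω) t ε η L m N h}
      ⊆ (⋃ v ∈ V, A v) ∪ ⋃ j ∈ Finset.range m, B j := by
    intro ω hω
    by_contra hcon
    simp only [mem_union, mem_iUnion, not_or, not_exists, hA, hB, mem_ofPred_eq, not_and, not_le,
      not_lt, Finset.mem_range, hend] at hcon
    refine hω fun n hn => ⟨fun j hj y hy => hcon.2 j hj n hn y hy, ?_⟩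
    exact hV2 _ _ (by positivity) fun v hv => (hcon.1 v hv n hn).le
  have hAle : ∀ v ∈ V, P.real (A v) ≤ Real.exp (-((2 + η) * L)) := fun v hv =>
    measureReal_exists_direction_ge_le hU hind hunif (hV1 v hv) hη0 hη1 hh hN hm hL0 ht hth hdir
  have hBle : ∀ j ∈ Finset.range m, P.real (B j) ≤ 4 * Real.exp (-((2 + η) * L)) := by
    intro j hj
    have hj1 : ((j + 1 : ℕ) : ℝ) ≤ m := by exact_mod_cast Finset.mem_range.1 hj
    have hjh : ((j + 1 : ℕ) : ℝ) * (h / m) ≤ h := by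
      calc _ ≤ (m : ℝ) * (h / m) := mul_le_mul_of_nonneg_right hj1 (by positivity)
        _ = h := by field_simp
    refine (measureReal_exists_osc_gt_le hU hind hunif hε (by positivity : (0 : ℝ) < 1 / m)
      ?_ hh hN hL (by positivity) (by rw [hend]; linarith) hosc).trans ?_
    · rw [one_div_mul_eq_div, div_le_iff₀ hm', mul_comm]; exact hmε
    · refine mul_le_mul_of_nonneg_left (Real.exp_le_exp.2 ?_) (by norm_num)
      nlinarith
  refine (measureReal_mono hsub (measure_ne_top _ _)).trans ((measureReal_union_le _ _).trans ?_)
  rw [add_mul]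
  refine add_le_add ((measureReal_biUnion_finset_le _ _).trans
    ((Finset.sum_le_sum hAle).trans_eq ?_)) ((measureReal_biUnion_finset_le _ _).trans
    ((Finset.sum_le_sum hBle).trans_eq ?_))
  · rw [Finset.sum_const, nsmul_eq_mul]
  · rw [Finset.sum_const, nsmul_eq_mul, Finset.card_range]; ring

/-! ### Borel–Cantelli on the geometric grid -/

lemma tendsto_log2_natCast : Tendsto (fun n : ℕ => log2 n) atTop atTop := by
  refine tendsto_atTop_mono' _ ?_
    (Real.tendsto_log_atTop.comp (Real.tendsto_log_atTop.comp tendsto_natCast_atTop_atTop))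
  filter_upwards [eventually_ge_atTop 3] with n hn
  have : (3 : ℝ) ≤ n := by exact_mod_cast hn
  simp only [Function.comp_apply, log2]
  rw [max_eq_left this]

lemma log2_le_of_le_sq {x y : ℝ} (hx : 3 ≤ x) (hy : y ≤ x ^ 2) :
    log2 y ≤ Real.log 2 + log2 x := by
  have h1 : 0 < Real.log x := Real.log_pos (by linarith)
  have hy3 : max y 3 ≤ x ^ 2 := max_le hy (by nlinarith)
  have h3 : (0 : ℝ) < max y 3 := lt_max_of_lt_right (by norm_num)
  rw [log2, log2, max_eq_left hx, ← Real.log_mul (by norm_num) h1.ne']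
  refine Real.log_le_log (Real.log_pos (lt_max_of_lt_right (by norm_num))) ?_
  refine (Real.log_le_log h3 hy3).trans_eq ?_
  rw [Real.log_pow]; norm_num

lemma log_mul_log_le_log2_ceil {ρ : ℝ} (hρ : 1 < ρ) {r : ℕ} (hr : 1 ≤ r) :
    Real.log (r * Real.log ρ) ≤ log2 (⌈ρ ^ r⌉₊ : ℝ) := by
  have hl : 0 < Real.log ρ := Real.log_pos hρ
  have hr' : (0 : ℝ) < r := by exact_mod_cast hr
  refine Real.log_le_log (by positivity) ?_
  rw [← Real.log_pow]
  exact Real.log_le_log (by positivity) ((Nat.le_ceil _).trans (le_max_left _ _))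

/-- Almost surely, along the geometric sequence of sample sizes, regularity holds eventually at all
the scales of a geometric grid which are not too small. -/
lemma exists_ae_eventually_regularAt [IsProbabilityMeasure P] {U : ℕ → Ω → ℝ}
    (hU : ∀ i, Measurable (U i)) (hind : iIndepFun U P)
    (hunif : ∀ i, pdf.IsUniform (U i) (Icc (0 : ℝ) 1) P volume) {t ε η : ℝ} (ht : 0 ≤ t)
    (hε : 0 < ε) (hη0 : 0 < η) (hη1 : η ≤ 1) {m : ℕ} (hm : 0 < m) (hmε : 6144 ≤ m * ε ^ 2)
    {ρ : ℝ} (hρ : 1 < ρ) (hρm : 2 ≤ ρ ^ m) :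
    ∃ c : ℝ, 1 ≤ c ∧ ∀ᵐ ω ∂P, ∀ᶠ r : ℕ in atTop, ∀ l : ℕ, t + (ρ ^ l)⁻¹ ≤ 1 →
      c * log2 (⌈ρ ^ r⌉₊ : ℝ) ≤ (⌈ρ ^ r⌉₊ : ℝ) * (ρ ^ l)⁻¹ →
      RegularAt (fun i => U i ω) t ε η (log2 (⌈ρ ^ r⌉₊ : ℝ)) m ⌈ρ ^ r⌉₊ (ρ ^ l)⁻¹ := by
  obtain ⟨C, c, hC, hc1, hbound⟩ :=
    exists_measureReal_not_regularAt_le hU hind hunif ht hε hη0 hη1 hm hmε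
  refine ⟨c, hc1, ?_⟩
  have hρ0 : 0 < ρ := by linarith
  have hlρ : 0 < Real.log ρ := Real.log_pos hρ
  set N : ℕ → ℕ := fun r => ⌈ρ ^ r⌉₊ with hN
  set L : ℕ → ℝ := fun r => log2 (N r : ℝ) with hL
  set D : ℕ → ℕ → Set Ω := fun r l =>
    {ω | t + (ρ ^ l)⁻¹ ≤ 1 ∧ c * L r ≤ N r * (ρ ^ l)⁻¹ ∧
      ¬ RegularAt (fun i => U i ω) t ε η (L r) m (N r) (ρ ^ l)⁻¹} with hD
  set S : ℕ → Set Ω := fun r => ⋃ l, D r l with hS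
  have hDle : ∀ r l, 1 ≤ L r → P.real (D r l) ≤ C * Real.exp (-((2 + η) * L r)) := by
    intro r l hLr
    by_cases h : t + (ρ ^ l)⁻¹ ≤ 1 ∧ c * L r ≤ N r * (ρ ^ l)⁻¹
    · exact (measureReal_mono (fun ω hω => hω.2.2)).trans
        (hbound (N r) _ (L r) (by positivity) h.1 hLr h.2)
    · have : D r l = ∅ := eq_empty_of_forall_notMem fun ω hω => h ⟨hω.1, hω.2.1⟩
      rw [this, measureReal_empty]
      positivity
  -- An admissible scale has `ρ ^ l ≤ N r ≤ ρ ^ r + 1 ≤ 2 ρ ^ r ≤ ρ ^ (r + m)`, so at most `r + m +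
  -- 1` scales matter. This factor uses up one power of `r`.
  have hSle : ∀ r, 1 ≤ L r →
      P.real (S r) ≤ (r + m + 1) * (C * Real.exp (-((2 + η) * L r))) := by
    intro r hLr
    have hsub : S r ⊆ ⋃ l ∈ Finset.range (r + m + 1), D r l := by
      intro ω hω
      obtain ⟨l, hl⟩ := mem_iUnion.1 hω
      refine mem_iUnion₂.2 ⟨l, ?_, hl⟩
      have h1 : 1 ≤ (N r : ℝ) * (ρ ^ l)⁻¹ := by
        refine le_trans ?_ hl.2.1
        nlinarith
      have hpl : 0 < ρ ^ l := by positivity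
      rw [← div_eq_mul_inv, one_le_div hpl] at h1
      have h2 : (N r : ℝ) ≤ ρ ^ r + 1 := (Nat.ceil_lt_add_one (by positivity)).le
      have h3 : (1 : ℝ) ≤ ρ ^ r := one_le_pow₀ hρ.le
      have h4 : ρ ^ l ≤ ρ ^ (r + m) := by
        rw [pow_add]; nlinarith
      have := (pow_le_pow_iff_right₀ hρ).1 h4
      simp only [Finset.mem_range]; omega
    refine (measureReal_mono hsub (measure_ne_top _ _)).trans
      ((measureReal_biUnion_finset_le _ _).trans
        ((Finset.sum_le_sum fun l _ => hDle r l hLr).trans_eq ?_))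
    rw [Finset.sum_const, nsmul_eq_mul, Finset.card_range]
    push_cast
    ring
  have hLlog : ∀ r : ℕ, 1 ≤ r → Real.log (r * Real.log ρ) ≤ L r := fun r hr =>
    log_mul_log_le_log2_ceil hρ hr
  have hlarge : ∀ᶠ r : ℕ in atTop, 1 ≤ Real.log (r * Real.log ρ) :=
    (Real.tendsto_log_atTop.comp
      (tendsto_natCast_atTop_atTop.atTop_mul_const hlρ)).eventually_ge_atTop 1
  have hsum : Summable fun r : ℕ =>
      (m + 2) * C * Real.log ρ ^ (-(2 + η)) * (r : ℝ) ^ (-(1 + η)) :=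
    (Real.summable_nat_rpow.2 (by linarith)).mul_left _
  have hSsum : Summable fun r => P.real (S r) := by
    refine Summable.of_norm_bounded_eventually_nat hsum ?_
    filter_upwards [hlarge, eventually_ge_atTop 1] with r hr hr1
    have hr' : (1 : ℝ) ≤ r := by exact_mod_cast hr1
    have hr0 : (0 : ℝ) < r := by linarith
    rw [Real.norm_of_nonneg measureReal_nonneg]
    have hx : 0 < r * Real.log ρ := by positivity
    have hexp : Real.exp (-((2 + η) * L r)) ≤ (r * Real.log ρ) ^ (-(2 + η)) := by
      rw [Real.rpow_def_of_pos hx]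
      refine Real.exp_le_exp.2 ?_
      nlinarith [hLlog r hr1]
    have hsplit : (r * Real.log ρ) ^ (-(2 + η))
        = (r : ℝ) ^ (-(1 + η)) * (r : ℝ)⁻¹ * Real.log ρ ^ (-(2 + η)) := by
      rw [Real.mul_rpow hr0.le hlρ.le, ← Real.rpow_neg_one, ← Real.rpow_add hr0]
      congr 2; ring
    calc P.real (S r) ≤ (r + m + 1) * (C * Real.exp (-((2 + η) * L r))) :=
          hSle r (hr.trans (hLlog r hr1))
      _ ≤ ((m + 2) * r) * (C * (r * Real.log ρ) ^ (-(2 + η))) := by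
          have : (r : ℝ) + m + 1 ≤ (m + 2) * r := by nlinarith [m.cast_nonneg (α := ℝ)]
          gcongr
      _ = _ := by rw [hsplit]; field_simp
  have hfin : ∑' r, P (S r) ≠ ∞ := by
    have : ∀ r, P (S r) = ENNReal.ofReal (P.real (S r)) := fun r => by
      rw [measureReal_def, ENNReal.ofReal_toReal (measure_ne_top _ _)]
    simp only [this]
    exact hSsum.tsum_ofReal_ne_top
  filter_upwards [ae_eventually_notMem hfin] with ω hω
  filter_upwards [hω] with r hr l h1 h2
  by_contra h3
  exact hr (mem_iUnion.2 ⟨l, h1, h2, h3⟩)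

/-! ### From the grid to all sample sizes and scales -/

/-- Regularity at one scale and sample size places the local processes with comparable parameters
close to the dilated Strassen ball. -/
lemma RegularAt.exists_near {u : ℕ → ℝ} {t ε b h L L' : ℝ} {m n N : ℕ} (hm : 0 < m)
    (hreg : RegularAt u t ε (1 / m) L' m N h) (hε : 0 ≤ ε) (hn : 0 < n) (hnN : n ≤ N) (hb : 0 < b)
    (hbh : b ≤ h) (hhb : h ≤ (1 + 1 / m) * b) (hL : 0 < L) (hLL' : L' ≤ (1 + 1 / m) * L)
    (hL' : 0 ≤ L') (hNn : (N : ℝ) ≤ (1 + 1 / m) ^ 2 * n) :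
    ∃ g ∈ √(2 : ℝ) • strassenBall, ∀ s ∈ Icc (0 : ℝ) 1,
      |(localProcess u n b t s) / √(2 * b * L) - g s| ≤ 20 * ε + 30 / m := by
  have hm' : (1 : ℝ) ≤ m := by exact_mod_cast hm
  have hm0 : (0 : ℝ) < m := by linarith
  have hn' : (0 : ℝ) < n := by exact_mod_cast hn
  have hh : 0 < h := hb.trans_le hbh
  set η : ℝ := 1 / m with hη
  have hη0 : 0 < η := by positivity
  have hη1 : η ≤ 1 := (div_le_one hm0).2 hm'
  set Δ : ℝ := √n * √(2 * b * L) with hΔ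
  have hΔ0 : 0 < Δ := by positivity
  have hΔ2 : Δ ^ 2 = 2 * (n * b * L) := by
    rw [hΔ, mul_pow, Real.sq_sqrt hn'.le, Real.sq_sqrt (by positivity)]; ring
  have hQ : N * h * L' ≤ (1 + η) ^ 4 * (n * b * L) := by
    calc N * h * L' ≤ ((1 + η) ^ 2 * n) * ((1 + η) * b) * ((1 + η) * L) := by gcongr
      _ = _ := by ring
  have hQ16 : √(N * h * L') ≤ 4 * Δ := by
    refine Real.sqrt_le_iff.2 ⟨by positivity, ?_⟩
    have h16 : (1 + η) ^ 4 ≤ 2 ^ 4 := pow_le_pow_left₀ (by positivity) (by linarith) 4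
    have : 0 < n * b * L := by positivity
    rw [mul_pow, hΔ2]
    nlinarith
  -- Space is measured at the grid scale `h` but the normalisation is that of `b`, so the local
  -- process at `b` is `W (b / h * s)`.
  set W : ℝ → ℝ := fun s => (centredCount u n (t + h * s) - centredCount u n t) / Δ with hW
  obtain ⟨hosc, hen⟩ := hreg n hnN
  have hpt : ∀ j : ℕ, t + h * (j / m) = t + j * (h / m) := fun j => by ring
  have hWosc : ∀ j < m, ∀ s, (j : ℝ) ≤ m * s → m * s ≤ j + 1 →
      |W s - W (j / m)| ≤ 4 * ε := by
    intro j hj s h1 h2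
    have hlow : t + j * (h / m) ≤ t + h * s := by
      rw [← hpt]
      have : (j : ℝ) / m ≤ s := by rw [div_le_iff₀ hm0]; linarith
      nlinarith
    have hup : t + h * s ≤ t + (j + 1 : ℕ) * (h / m) := by
      rw [← hpt]
      have : s ≤ ((j + 1 : ℕ) : ℝ) / m := by rw [le_div_iff₀ hm0]; push_cast; linarith
      nlinarith
    simp only [hW]
    rw [← sub_div, sub_sub_sub_cancel_right, hpt, abs_div, abs_of_pos hΔ0, div_le_iff₀ hΔ0]
    refine (hosc j hj _ ⟨hlow, hup⟩).trans ?_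
    nlinarith
  -- One factor `(1 + η) ^ 4` comes from the regularity event and another from `hQ`, whence `1 + θ =
  -- (1 + η) ^ 4`.
  have hWen : m * ∑ j ∈ Finset.range m, (W ((j + 1 : ℕ) / m) - W (j / m)) ^ 2
      ≤ 2 * (1 + ((1 + η) ^ 4 - 1)) ^ 2 := by
    simp only [hW]
    have hs : ∀ j ∈ Finset.range m, ((centredCount u n (t + h * ((j + 1 : ℕ) / m))
          - centredCount u n t) / Δ - (centredCount u n (t + h * (j / m))
          - centredCount u n t) / Δ) ^ 2
        = (Δ ^ 2)⁻¹ * (centredCount u n (t + (j + 1 : ℕ) * (h / m))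
          - centredCount u n (t + j * (h / m))) ^ 2 := by
      intro j _
      rw [← sub_div, sub_sub_sub_cancel_right, hpt, hpt, div_pow, div_eq_inv_mul]
    rw [Finset.sum_congr rfl hs, ← Finset.mul_sum]
    have hsq : √(N * h * L' / m) ^ 2 = N * h * L' / m := Real.sq_sqrt (by positivity)
    calc _ ≤ (m : ℝ) * ((Δ ^ 2)⁻¹ * ((1 + η) * ((1 + η) * (2 * √(N * h * L' / m)))) ^ 2) := by
          gcongr
      _ = (m : ℝ) * ((Δ ^ 2)⁻¹ * ((1 + η) ^ 4 * 4 * √(N * h * L' / m) ^ 2)) := by ring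
      _ = (Δ ^ 2)⁻¹ * (4 * (1 + η) ^ 4 * (N * h * L')) := by rw [hsq]; field_simp
      _ ≤ (Δ ^ 2)⁻¹ * (4 * (1 + η) ^ 4 * ((1 + η) ^ 4 * (n * b * L))) := by gcongr
      _ = _ := by rw [hΔ2]; field_simp; ring
  have hβ : m * (1 - b / h) ≤ 1 := by
    have : m * h - m * b ≤ h := by
      have h1 : m * h ≤ m * b + b := by
        calc m * h ≤ m * ((1 + η) * b) := by gcongr
          _ = m * b + b := by rw [hη]; field_simp
      linarith
    have e : m * (1 - b / h) = (m * h - m * b) / h := by field_simp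
    rw [e, div_le_one hh]
    exact this
  obtain ⟨g, hg, hgW⟩ := exists_near_strassenBall hm (W := W) (by simp [hW]) (by positivity)
    (by linarith [one_le_pow₀ (by linarith : 1 ≤ 1 + η) (n := 4)]) hWosc hWen (by positivity)
    ((div_le_one hh).2 hbh) hβ
  refine ⟨g, hg, fun s hs => ?_⟩
  have h1 : localProcess u n b t s / √(2 * b * L) = W (b / h * s) := by
    have : h * (b / h * s) = b * s := by field_simp
    rw [localProcess_eq u hn, div_div, hW]
    simp only [this, hΔ]
  rw [h1]
  refine (hgW s hs).trans ?_
  have h2 : (1 + η) ^ 4 - 1 ≤ 15 * η := by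
    have e2 : η ^ 2 ≤ η := pow_le_of_le_one hη0.le hη1 (by norm_num)
    have e3 : η ^ 3 ≤ η := pow_le_of_le_one hη0.le hη1 (by norm_num)
    have e4 : η ^ 4 ≤ η := pow_le_of_le_one hη0.le hη1 (by norm_num)
    nlinarith
  have h3 : 30 / (m : ℝ) = 30 * η := by rw [hη]; ring
  rw [h3]; linarith

lemma two_le_one_add_inv_pow {m : ℕ} (hm : 0 < m) : (2 : ℝ) ≤ (1 + 1 / m) ^ m := by
  have hm0 : (0 : ℝ) < m := by exact_mod_cast hm
  have h0 : (0 : ℝ) ≤ 1 / m := by positivity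
  have := one_add_mul_le_pow (a := 1 / (m : ℝ)) (by linarith) m
  rw [mul_one_div_cancel hm0.ne'] at this
  linarith

/-- For each tolerance, almost surely the local processes at the scales `k n ≤ b ≤ h n` are
eventually uniformly within this tolerance of the dilated Strassen ball. -/
lemma ae_eventually_forall_exists_near [IsProbabilityMeasure P] {U : ℕ → Ω → ℝ}
    (hU : ∀ i, Measurable (U i)) (hind : iIndepFun U P)
    (hunif : ∀ i, pdf.IsUniform (U i) (Icc (0 : ℝ) 1) P volume) {k h : ℕ → ℝ}
    (hk : LocalStrongInvariance k) (hh : LocalStrongInvariance h) {t : ℝ} (ht0 : 0 ≤ t)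
    (ht1 : t < 1) {ε : ℝ} (hε : 0 < ε) :
    ∀ᵐ ω ∂P, ∀ᶠ n : ℕ in atTop, ∀ b ∈ Icc (k n) (h n), ∃ g ∈ √(2 : ℝ) • strassenBall,
      ∀ s ∈ Icc (0 : ℝ) 1,
        |(localProcess (fun i => U i ω) n b t s) / √(2 * b * log2 n) - g s| ≤ 21 * ε := by
  obtain ⟨m, hm⟩ := exists_nat_gt (max (6144 / ε ^ 2) (30 / ε))
  have hm1 : 6144 / ε ^ 2 < m := (le_max_left _ _).trans_lt hm
  have hm2 : 30 / ε < m := (le_max_right _ _).trans_lt hm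
  have hm0 : (0 : ℝ) < m := lt_trans (by positivity) hm2
  have hmpos : 0 < m := by exact_mod_cast hm0
  have hmε : 6144 ≤ m * ε ^ 2 := ((div_lt_iff₀ (by positivity)).1 hm1).le
  have hmε' : 30 / (m : ℝ) ≤ ε := by
    rw [div_le_iff₀ hm0, mul_comm]; exact ((div_lt_iff₀ hε).1 hm2).le
  set η : ℝ := 1 / m with hη
  have hη0 : 0 < η := by positivity
  have hη1 : η ≤ 1 := (div_le_one hm0).2 (by exact_mod_cast hmpos)
  set ρ : ℝ := 1 + η with hρ
  have hρ1 : 1 < ρ := by linarith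
  have hρ0 : 0 < ρ := by linarith
  have hρ2 : ρ ≤ 2 := by linarith
  obtain ⟨c, hc1, hae⟩ := exists_ae_eventually_regularAt hU hind hunif ht0 hε hη0 hη1 hmpos hmε
    hρ1 (two_le_one_add_inv_pow hmpos)
  filter_upwards [hae] with ω hω
  obtain ⟨r₀, hr₀⟩ := eventually_atTop.1 hω
  -- The third condition absorbs the rounding in `N ≤ ρ ^ 2 * n`, the fourth gives `log2 N ≤ ρ *
  -- log2 n`, the sixth makes the scale admissible (its `2` bounds `ρ`), and the last keeps `t + h'
  -- ≤ 1`.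
  filter_upwards [eventually_ge_atTop 4,
    tendsto_natCast_atTop_atTop.eventually_ge_atTop (ρ ^ r₀),
    (tendsto_natCast_atTop_atTop.const_mul_atTop
      (by nlinarith : 0 < ρ ^ 2 - ρ)).eventually_ge_atTop 1,
    (tendsto_log2_natCast.const_mul_atTop hη0).eventually_ge_atTop (Real.log 2),
    tendsto_log2_natCast.eventually_gt_atTop 0,
    hk.tendsto_div.eventually_ge_atTop (2 * c),
    hh.tendsto_zero.eventually_le_const (by linarith : (0 : ℝ) < (1 - t) / 2)]
    with n hn4 hnr hnρ hnL hL hnk hnh b hb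
  have hn4' : (4 : ℝ) ≤ n := by exact_mod_cast hn4
  have hn0 : 0 < n := by omega
  have hn0' : (0 : ℝ) < n := by linarith
  have hb0 : 0 < b := (hk.pos n hn0).trans_le hb.1
  have hbh : b ≤ (1 - t) / 2 := hb.2.trans hnh
  obtain ⟨r, hr1, hr2⟩ := exists_nat_pow_near (x := (n : ℝ)) (by linarith) hρ1
  have hrr : r₀ ≤ r + 1 := ((pow_lt_pow_iff_right₀ hρ1).1 (hnr.trans_lt hr2)).le
  obtain ⟨l, hl1, hl2⟩ := exists_nat_pow_near (x := b⁻¹) (y := ρ)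
    ((one_le_inv₀ hb0).2 (by linarith)) hρ1
  set N : ℕ := ⌈ρ ^ (r + 1)⌉₊ with hN
  set h' : ℝ := (ρ ^ l)⁻¹ with hh'
  have hpl : 0 < ρ ^ l := by positivity
  have hbh' : b ≤ h' := by
    rw [hh']; exact (le_inv_comm₀ hpl hb0).1 hl1
  have hhb' : h' ≤ ρ * b := by
    rw [hh', inv_le_comm₀ hpl (by positivity), mul_inv, inv_mul_le_iff₀ hρ0]
    rw [pow_succ] at hl2
    linarith
  have hnN : n ≤ N := by
    have : (n : ℝ) ≤ N := hr2.le.trans (Nat.le_ceil _)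
    exact_mod_cast this
  have hnN' : (n : ℝ) ≤ N := by exact_mod_cast hnN
  have hNn : (N : ℝ) ≤ ρ ^ 2 * n := by
    have h1 : (N : ℝ) ≤ ρ ^ (r + 1) + 1 := (Nat.ceil_lt_add_one (by positivity)).le
    rw [pow_succ] at h1
    nlinarith
  have hLN : log2 (N : ℝ) ≤ ρ * log2 n := by
    have h1 : (N : ℝ) ≤ (n : ℝ) ^ 2 := by
      have : ρ ^ 2 ≤ n := (pow_le_pow_left₀ hρ0.le hρ2 2).trans (by norm_num; linarith)
      nlinarith
    have := log2_le_of_le_sq (by linarith : (3 : ℝ) ≤ n) h1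
    rw [hρ]; linarith
  have hLN0 : 0 ≤ log2 (N : ℝ) := by
    refine hL.le.trans ?_
    have h1 : (3 : ℝ) ≤ n := by linarith
    rw [log2, log2, max_eq_left h1, max_eq_left (h1.trans hnN')]
    exact Real.log_le_log (Real.log_pos (by linarith)) (Real.log_le_log hn0' hnN')
  have hcond : c * log2 (N : ℝ) ≤ N * h' := by
    have h1 : 2 * c * log2 n ≤ n * k n := (le_div_iff₀ hL).1 hnk
    calc c * log2 (N : ℝ) ≤ c * (2 * log2 n) := by gcongr; exact hLN.trans (by gcongr)
      _ = 2 * c * log2 n := by ring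
      _ ≤ n * k n := h1
      _ ≤ N * h' := by
          have := hk.pos n hn0
          have := hb.1.trans hbh'
          gcongr
  have hreg := hr₀ (r + 1) hrr l (by nlinarith) hcond
  obtain ⟨g, hg, hgs⟩ := hreg.exists_near hmpos hε.le hn0 hnN hb0 hbh' hhb' hL hLN hLN0 hNn
  exact ⟨g, hg, fun s hs => (hgs s hs).trans (by linarith)⟩

end LocalEmpirical

theorem theorem1 {Ω : Type*} [MeasurableSpace Ω] (P : Measure Ω) [IsProbabilityMeasure P]
    (U : ℕ → Ω → ℝ) (hU_meas : ∀ i, Measurable (U i)) (hU_indep : iIndepFun U P)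
    (hU_unif : ∀ i, pdf.IsUniform (U i) (Icc (0 : ℝ) 1) P volume)
    (k h : ℕ → ℝ)
    (hk : LocalEmpirical.LocalStrongInvariance k) (hh : LocalEmpirical.LocalStrongInvariance h)
    (hkh : ∀ n, 1 ≤ n → k n < h n / 2)
    (t : ℝ) (ht0 : 0 ≤ t) (ht1 : t < 1) :
    ∀ᵐ ω ∂P, Tendsto
      (fun n : ℕ => ⨆ b ∈ Icc (k n) (h n),
        ⨅ g ∈ √(2 : ℝ) • LocalEmpirical.strassenBall,
          LocalEmpirical.supNorm (fun s =>
            LocalEmpirical.localProcess (fun i => U i ω) n b t s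
              / √(2 * b * LocalEmpirical.log2 n) - g s))
      atTop (𝓝 0) := by
  -- Countably many tolerances `1 / (q + 1)` leave a single null set.
  have hae : ∀ᵐ ω ∂P, ∀ q : ℕ, ∀ᶠ n : ℕ in atTop, ∀ b ∈ Icc (k n) (h n),
      ∃ g ∈ √(2 : ℝ) • LocalEmpirical.strassenBall, ∀ s ∈ Icc (0 : ℝ) 1,
        |(LocalEmpirical.localProcess (fun i => U i ω) n b t s)
          / √(2 * b * LocalEmpirical.log2 n) - g s| ≤ 21 * (1 / ((q : ℝ) + 1)) :=
    ae_all_iff.2 fun q => LocalEmpirical.ae_eventually_forall_exists_near hU_meas hU_indep hU_unif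
      hk hh ht0 ht1 (by positivity)
  filter_upwards [hae] with ω hω
  have hlim : Tendsto (fun q : ℕ => ENNReal.ofReal (21 * (1 / ((q : ℝ) + 1)))) atTop (𝓝 0) := by
    have := (tendsto_one_div_add_atTop_nhds_zero_nat (𝕜 := ℝ)).const_mul 21
    simpa using ENNReal.tendsto_ofReal this
  refine ENNReal.tendsto_nhds_zero.2 fun δ hδ => ?_
  obtain ⟨q, hq⟩ := (ENNReal.tendsto_nhds_zero.1 hlim δ hδ).exists
  filter_upwards [hω q] with n hn
  refine le_trans (iSup₂_le fun b hb => ?_) hq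
  obtain ⟨g, hg, hgs⟩ := hn b hb
  refine iInf₂_le_of_le g hg (iSup₂_le fun s hs => ?_)
  rw [Real.enorm_eq_ofReal_abs]
  exact ENNReal.ofReal_le_ofReal (hgs s hs)
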